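/- Let $r,k\ge 0$ and $s_1,\dots,s_k\ge 0$ be integers. The complete bipartite supernova quiver $\Gamma$ has vertex set $I$ consisting of the vertices $(l)$ for $1\le l\le r$ and $(i;j)$ for $1\le i\le k$, $0\le j\le s_i$; it has one arrow $(l)\to(i;0)$ for all $l,i$, and one arrow $(i;j+1)\to(i;j)$ for all $i$ and $0\le j<s_i$. Let ${\bm\mu}=(\mu^1,\dots,\mu^k)$ be a tuple of non-zero partitions $\mu^i=(\mu^i_1\ge\cdots\ge\mu^i_{s_i+1}\ge 0)$, and let $\mathbf v_{\bm\mu}\in\mathbb Z_{\ge0}^I$ be the dimension vector with coordinate $1$ at each $(l)$ and $|\mu^i|-\sum_{f=1}^{j}\mu^i_f$ at $(i;j)$. Let $(\ ,\ )$ be the symmetric bilinear form on $\mathbb Z^I$ with $(\mathbf e_a,\mathbf e_a)=2$ and $(\mathbf e_a,\mathbf e_b)=-(\text{number of edges of }\Gamma\text{ joining }a\text{ and }b)$ for $a\ne b$. Assume that $\mathbf v_{\bm\mu}$ lies in the fundamental set $M_\Gamma$, the set of all $\mathbf u\in\mathbb Z_{\ge0}^I\smallsetminus\{0\}$ with connected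 support such that $(\mathbf e_a,\mathbf u)\le 0$ for all $a\in I$. (Then $r\ge|\mu^i|+\mu^i_1$ for all $i$.) The Kac polynomial $A_{\Gamma,\mathbf v}(t)\in\mathbb Z[t]$ is the polynomial such that, for every finite field $\mathbb F_q$, $A_{\Gamma,\mathbf v}(q)$ is the number of isomorphism classes of absolutely indecomposable representations of $\Gamma$ over $\mathbb F_q$ of dimension vector $\mathbf v$ (those that are indecomposable over $\mathbb F_q$ and over each of its finite extensions). For a sequence $c=(c_0,\dots,c_d)$ of non-negative integers with sum $r$, cut $\{1,\dots,r\}$ into consecutive blocks of sizes $c_d,c_{d-1},\dots,c_0$, in this order, and let $S_c\subset S_r$ be the set of permutations $w$ such that $w^{-1}(x)<w^{-1}(y)$ whenever $x<y$ lie in the same block. Put $\tilde\mu^i=(r-|\mu^i|,\mu^i_1,\dots,\mu^i_{s_i+1})$ and $S_{\tilde{\bm\mu}}=S_{\tilde\mu^1}\times\cdots\times S_{\tilde\mu^k}\subset (S_r)^k$. For $\mathbf w=(w_1,\dots,w_k)\in(S_r)^k$, the coloured inversion graph $K_{\mathbf w}$ is the multigraph with vertices $1,\dots,r$ and, for all $j<i$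 and all $t$ with $w_t(i)<w_t(j)$, an edge of colour $t$ between $i$ and $j$. Put $$R_{\mathbf w}(q)=\sum_{K}(q-1)^{b_1(K)},\qquad b_1(K)=e(K)-r+1,$$ where $K$ runs over the connected subgraphs of $K_{\mathbf w}$ containing all $r$ vertices, and $e(K)$ is the number of edges of $K$ (so $R_{\mathbf w}=0$ if $K_{\mathbf w}$ is not connected). Then the Kac polynomial $A_{\Gamma,\mathbf v_{\bm\mu}}$ exists, and $$A_{\Gamma,\mathbf v_{\bm\mu}}(q)=\sum_{\mathbf w\in S_{\tilde{\bm\mu}}}R_{\mathbf w}(q).$$ -/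

import Mathlib

noncomputable section

namespace Supernova

open Polynomial

/-! ## Representations of quivers -/

section Representations

variable {I : Type} [Quiver I]

/-- A representation of the quiver `I` over `κ` in coordinates: the space at the vertex `i` is
`n i → κ`, and an arrow `i ⟶ j` is sent to a matrix. A representation of dimension vector `v` is
the case `n i = Fin (v i)`. -/
def Rep (κ : Type) (n : I → Type) : Type :=
  ∀ ⦃i j : I⦄, (i ⟶ j) → Matrix (n j) (n i) κ

/-- Two representations are isomorphic: there are linear isomorphisms at the vertices that
intertwine the maps of all arrows. -/
def Rep.Iso {κ : Type} [Field κ] {n m : I → Type} [∀ i, Fintype (n i)] [∀ i, Fintype (m i)]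
    (φ : Rep κ n) (ψ : Rep κ m) : Prop :=
  ∃ g : ∀ i, (n i → κ) ≃ₗ[κ] (m i → κ), ∀ (i j : I) (a : i ⟶ j) (x : n i → κ),
    g j ((φ a).mulVec x) = (ψ a).mulVec (g i x)

/-- The direct sum of two representations. -/
def Rep.directSum {κ : Type} [Field κ] {n m : I → Type} (φ : Rep κ n) (ψ : Rep κ m) :
    Rep κ (fun i => n i ⊕ m i) :=
  fun _ _ a => Matrix.fromBlocks (φ a) 0 0 (ψ a)

/-- Extension of scalars. -/
def Rep.baseChange {κ : Type} [Field κ] {n : I → Type} (φ : Rep κ n) (L : Type) [Field L]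
    [Algebra κ L] : Rep L n :=
  fun _ _ a => (φ a).map (algebraMap κ L)

/-- A representation is indecomposable if it is non-zero and not isomorphic to a direct sum of
two non-zero representations. -/
def Rep.Indecomposable {κ : Type} [Field κ] {v : I → ℕ} (φ : Rep κ (fun i => Fin (v i))) : Prop :=
  v ≠ 0 ∧ ∀ (v₁ v₂ : I → ℕ) (φ₁ : Rep κ (fun i => Fin (v₁ i))) (φ₂ : Rep κ (fun i => Fin (v₂ i))),
    φ.Iso (φ₁.directSum φ₂) → v₁ = 0 ∨ v₂ = 0

/-- A representation is absolutely indecomposable if it is indecomposable and stays so over every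
finite extension of the ground field. -/
def Rep.AbsolutelyIndecomposable {κ : Type} [Field κ] {v : I → ℕ}
    (φ : Rep κ (fun i => Fin (v i))) : Prop :=
  φ.Indecomposable ∧ ∀ (L : Type) [Field L] [Algebra κ L] [FiniteDimensional κ L],
    (φ.baseChange L).Indecomposable

/-- Isomorphism as an equivalence relation on the representations of dimension vector `v`. -/
def isoSetoid (κ : Type) [Field κ] (v : I → ℕ) : Setoid (Rep κ (fun i => Fin (v i))) where
  r φ ψ := φ.Iso ψ
  iseqv :=
    { refl := fun _ => ⟨fun _ => LinearEquiv.refl κ _, fun _ _ _ _ => rfl⟩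
      symm := by
        rintro φ ψ ⟨g, hg⟩
        refine ⟨fun i => (g i).symm, fun i j a x => ?_⟩
        rw [LinearEquiv.symm_apply_eq, hg, LinearEquiv.apply_symm_apply]
      trans := by
        rintro φ ψ χ ⟨g, hg⟩ ⟨h, hh⟩
        refine ⟨fun i => (g i).trans (h i), fun i j a x => ?_⟩
        simp only [LinearEquiv.trans_apply, hg, hh] }

/-- The number of isomorphism classes of absolutely indecomposable representations of dimension
vector `v` over `κ`. -/
def numAbsIndec (I : Type) [Quiver I] (κ : Type) [Field κ] (v : I → ℕ) : ℕ :=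
  Nat.card {c : Quotient (isoSetoid κ v) //
    ∃ φ : Rep κ (fun i => Fin (v i)), φ.AbsolutelyIndecomposable ∧ Quotient.mk _ φ = c}

/-- The property that characterizes the Kac polynomial of a finite quiver with dimension vector
`v`: its value at `q` counts the isomorphism classes of absolutely indecomposable representations
of dimension vector `v` over the field with `q` elements, for every `q`. -/
def IsKacPolynomial (I : Type) [Quiver I] (v : I → ℕ) (A : ℤ[X]) : Prop :=
  ∀ (κ : Type) [Field κ] [Fintype κ],
    A.eval (Fintype.card κ : ℤ) = (numAbsIndec I κ v : ℤ)

open Classical in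
/-- The Kac polynomial of a quiver with dimension vector `v`: the polynomial with the
property `IsKacPolynomial` (with value `0` if there were none). -/
def kacPolynomial (I : Type) [Quiver I] (v : I → ℕ) : ℤ[X] :=
  if h : ∃ A : ℤ[X], IsKacPolynomial I v A then h.choose else 0

end Representations

/-! ## The fundamental set of a quiver -/

section Roots

/-- The entries of the Cartan matrix of a quiver without loops: `2` on the diagonal, and
minus the number of edges between `i` and `j` elsewhere. -/
def cartan (I : Type) [DecidableEq I] [Quiver I] (i j : I) : ℤ :=
  if i = j then 2 else -((Nat.card (i ⟶ j) : ℤ) + (Nat.card (j ⟶ i) : ℤ))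

/-- The symmetric bilinear form on `ℤ^I` given by the Cartan matrix. -/
def cartanForm (I : Type) [Fintype I] [DecidableEq I] [Quiver I] (u v : I → ℤ) : ℤ :=
  ∑ i, ∑ j, cartan I i j * u i * v j

/-- The simple graph underlying a quiver (only used to speak of connectedness). -/
def underlyingGraph (I : Type) [Quiver I] : SimpleGraph I :=
  SimpleGraph.fromRel fun i j => Nonempty (i ⟶ j)

/-- The fundamental set `M`: the non-zero vectors with non-negative coordinates, with
connected support, such that `(e_i, u) ≤ 0` for all vertices `i`. -/
def fundamentalSet (I : Type) [Fintype I] [DecidableEq I] [Quiver I] : Set (I → ℕ) :=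
  {u | u ≠ 0 ∧ ((underlyingGraph I).induce {i | u i ≠ 0}).Connected ∧
    ∀ i, cartanForm I (Pi.single i 1) (fun j => (u j : ℤ)) ≤ 0}

end Roots

/-! ## The complete bipartite supernova quiver -/

/-- The vertices: `short l` is the vertex `(l)`, and `long i j` is the vertex `(i;j)`,
`0 ≤ j ≤ s i`. -/
inductive Vertex (r : ℕ) {k : ℕ} (s : Fin k → ℕ) : Type
  | short (l : Fin r) : Vertex r s
  | long (i : Fin k) (j : Fin (s i + 1)) : Vertex r s
  deriving DecidableEq, Fintype

/-- The arrows: one arrow `(l) ⟶ (i;0)` for all `l` and `i`, and one arrow `(i;j+1) ⟶ (i;j)` for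
all `i` and `0 ≤ j < s i`. -/
inductive Arrow (r : ℕ) {k : ℕ} (s : Fin k → ℕ) : Vertex r s → Vertex r s → Type
  | short (l : Fin r) (i : Fin k) : Arrow r s (Vertex.short l) (Vertex.long i 0)
  | leg (i : Fin k) (j : Fin (s i)) : Arrow r s (Vertex.long i j.succ) (Vertex.long i j.castSucc)

instance (r : ℕ) {k : ℕ} (s : Fin k → ℕ) : Quiver (Vertex r s) where
  Hom := Arrow r s

/-- The dimension vector attached to a tuple of partitions, where `μ i f` is the part number `f + 1`
of the `i`-th partition: it is `1` at `(l)`, and at `(i;j)` it is the size of the `i`-th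
partition minus its first `j` parts, that is, the sum of the remaining parts. -/
def dimVector (r : ℕ) {k : ℕ} {s : Fin k → ℕ} (μ : ∀ i, Fin (s i + 1) → ℕ) : Vertex r s → ℕ
  | Vertex.short _ => 1
  | Vertex.long i j => ∑ f ∈ Finset.Ici j, μ i f

/-! ## Permutations and inversion graphs -/

/-- Cut `0, …, r - 1` into consecutive blocks of sizes `c (d-1), …, c 1, c 0`, in this order.
`InBlock c p x` says that `x` is in the block of size `c p`. -/
def InBlock {r d : ℕ} (c : Fin d → ℕ) (p : Fin d) (x : Fin r) : Prop :=
  ∑ f ∈ Finset.Ioi p, c f ≤ (x : ℕ) ∧ (x : ℕ) < ∑ f ∈ Finset.Ici p, c f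

open Classical in
/-- The permutations `w` such that `w⁻¹` is increasing on each of the blocks given by `c`. -/
def blockPerms (r : ℕ) {d : ℕ} (c : Fin d → ℕ) : Finset (Equiv.Perm (Fin r)) :=
  Finset.univ.filter fun w => ∀ (p : Fin d) (x y : Fin r),
    InBlock c p x → InBlock c p y → x < y → w⁻¹ x < w⁻¹ y

/-- The sequence `(r - |μ|, μ₁, μ₂, …)` attached to the partition `μ = (μ₁, μ₂, …)`; it is used for
`|μ| ≤ r` only. -/
def tilde (r : ℕ) {d : ℕ} (μ : Fin d → ℕ) : Fin (d + 1) → ℕ :=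
  Fin.cons (r - ∑ f, μ f) μ

/-- The set `S_{μ̃} = S_{μ̃^1} × ⋯ × S_{μ̃^k}` of tuples of permutations. -/
def permTuples (r : ℕ) {k : ℕ} {s : Fin k → ℕ} (μ : ∀ i, Fin (s i + 1) → ℕ) :
    Finset (Fin k → Equiv.Perm (Fin r)) :=
  Fintype.piFinset fun i => blockPerms r (tilde r (μ i))

/-- The edges of the inversion graph of `w = (w_1, …, w_k)`: an edge of colour `t` between `j` and
`i`, written `(t, j, i)`, for `j < i` with `w_t(i) < w_t(j)`. -/
def inversionEdges {r k : ℕ} (w : Fin k → Equiv.Perm (Fin r)) :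
    Finset (Fin k × Fin r × Fin r) :=
  Finset.univ.filter fun e => e.2.1 < e.2.2 ∧ w e.1 e.2.2 < w e.1 e.2.1

/-- The graph on all `r` vertices with the coloured edges `K` is connected. -/
def IsConnectedSpanning {r k : ℕ} (K : Finset (Fin k × Fin r × Fin r)) : Prop :=
  (SimpleGraph.fromRel fun j i : Fin r => ∃ t, (t, j, i) ∈ K).Connected

open Classical in
/-- The polynomial `R_w(q) = ∑ (q - 1)^{b₁(K)}`, over the connected spanning subgraphs `K` of the
inversion graph of `w`, where `b₁(K) = e(K) - r + 1`. The exponent is not truncated, as a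
connected graph on `r` vertices has at least `r - 1` edges. -/
def R {r k : ℕ} (w : Fin k → Equiv.Perm (Fin r)) : ℤ[X] :=
  ∑ K ∈ (inversionEdges w).powerset.filter fun K => IsConnectedSpanning K,
    (X - 1) ^ (K.card + 1 - r)

end Supernova

end

/-! Absolutely indecomposable representations are put into a normal form on which isomorphisms act
through a torus, and the normal forms are counted.

If all idempotent endomorphisms are trivial, then at each `i` the `r` vectors coming from the short
vertices span the space at `(i;0)`, and the leg is a chain of subspaces
(`Rep.good_of_trivialIdempotents`). Gaussian elimination, as for Schubert cells, then gives levels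
`a i x`, such that the space at `(i;j)` has a basis indexed by the `x` with `j < a i x`, and one
scalar `u (i, y, x)` for each pair `y < x` with `a i y < a i x` (`Rep.Good.exists_normalForm`).

The levels are isomorphism invariants (`levels_eq_of_iso`), and a homomorphism between normal forms
with the same levels is diagonal, with entries the scalars `t l` at the short vertices
(`isHom_normalForm_apply`). It multiplies each parameter by `t x / t y` or its inverse
(`scaledBy_of_isHom`). Regard the support of `u` as a graph on `r` vertices: endomorphisms
correspond to functions `t` that are constant on its components, so indecomposability means
connectedness. This does not depend on the field, so it is the same as absolute indecomposability
(`absolutelyIndecomposable_iff`). For connected support the stabilizer consists of the constants,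
and over `𝔽_q` each isomorphism class accounts for `(q-1)^(r-1)` parameters
(`card_normalFormParam`).

The levels with the given dimension vector correspond to the tuples `w` of block permutations, and
the pairs carrying parameters are the inversions of `w` (`exists_mem_blockPerms`, `inversion_iff`).
Summing `(q-1)^e(K)` over the connected supports `K` and dividing by `(q-1)^(r-1)` gives the
formula. The fundamental set supplies `|μ^i| ≤ r` and `r > 0`. -/

namespace Supernova

/-! ### Homomorphisms, base change, and indecomposability through idempotents -/

section Homs

variable {I : Type} [Quiver I] {κ : Type} [Field κ]

/-- A family of linear maps at the vertices that intertwines the maps of all arrows. -/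
def Rep.IsHom {n m : I → Type} [∀ i, Fintype (n i)] [∀ i, Fintype (m i)]
    (φ : Rep κ n) (ψ : Rep κ m) (g : ∀ i, (n i → κ) →ₗ[κ] (m i → κ)) : Prop :=
  ∀ (i j : I) (a : i ⟶ j) (x : n i → κ), g j ((φ a).mulVec x) = (ψ a).mulVec (g i x)

/-- Every idempotent endomorphism is `0` or `1`. -/
def Rep.TrivialIdempotents {n : I → Type} [∀ i, Fintype (n i)] (φ : Rep κ n) : Prop :=
  ∀ e : ∀ i, (n i → κ) →ₗ[κ] (n i → κ), φ.IsHom φ e → (∀ i x, e i (e i x) = e i x) →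
    (∀ i, e i = 0) ∨ ∀ i, e i = LinearMap.id

section

variable {n m o : I → Type} [∀ i, Fintype (n i)] [∀ i, Fintype (m i)] [∀ i, Fintype (o i)]

theorem Rep.Iso.symm {φ : Rep κ n} {ψ : Rep κ m} (h : φ.Iso ψ) : ψ.Iso φ := by
  obtain ⟨g, hg⟩ := h
  refine ⟨fun i => (g i).symm, fun i j a x => ?_⟩
  rw [LinearEquiv.symm_apply_eq, hg, LinearEquiv.apply_symm_apply]

theorem Rep.Iso.trans {φ : Rep κ n} {ψ : Rep κ m} {χ : Rep κ o} (h : φ.Iso ψ) (h' : ψ.Iso χ) :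
    φ.Iso χ := by
  obtain ⟨g, hg⟩ := h
  obtain ⟨g', hg'⟩ := h'
  exact ⟨fun i => (g i).trans (g' i), fun i j a x => by simp only [LinearEquiv.trans_apply, hg, hg']⟩

theorem Rep.Iso.trivialIdempotents {φ : Rep κ n} {ψ : Rep κ m} (h : φ.Iso ψ)
    (hφ : φ.TrivialIdempotents) : ψ.TrivialIdempotents := by
  obtain ⟨g, hg⟩ := h
  intro e he hee
  have hg' : ∀ (i j : I) (a : i ⟶ j) x,
      (g j).symm ((ψ a).mulVec x) = (φ a).mulVec ((g i).symm x) := fun i j a x => by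
    rw [LinearEquiv.symm_apply_eq, hg, LinearEquiv.apply_symm_apply]
  have key := hφ (fun i => (g i).symm.toLinearMap ∘ₗ e i ∘ₗ (g i).toLinearMap)
    (fun i j a x => by simp [hg, he i j a, hg']) (fun i x => by simp [hee])
  refine key.imp (fun h i => LinearMap.ext fun x => ?_) (fun h i => LinearMap.ext fun x => ?_)
  · have := congrArg (g i) (LinearMap.congr_fun (h i) ((g i).symm x))
    simpa using this
  · have := congrArg (g i) (LinearMap.congr_fun (h i) ((g i).symm x))
    simpa using this

theorem Rep.Iso.baseChange [∀ i, DecidableEq (n i)] [∀ i, DecidableEq (m i)]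
    {φ : Rep κ n} {ψ : Rep κ m} (h : φ.Iso ψ) (L : Type) [Field L] [Algebra κ L] :
    (φ.baseChange L).Iso (ψ.baseChange L) := by
  obtain ⟨g, hg⟩ := h
  let G : ∀ i, Matrix (m i) (n i) κ := fun i => LinearMap.toMatrix' (g i).toLinearMap
  let H : ∀ i, Matrix (n i) (m i) κ := fun i => LinearMap.toMatrix' (g i).symm.toLinearMap
  have hGH : ∀ i, G i * H i = 1 := fun i => by
    simp only [G, H]
    rw [← LinearMap.toMatrix'_comp]; simp
  have hHG : ∀ i, H i * G i = 1 := fun i => by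
    simp only [G, H]
    rw [← LinearMap.toMatrix'_comp]; simp
  have hG : ∀ (i j : I) (a : i ⟶ j), G j * φ a = ψ a * G i := fun i j a => by
    have hGv : ∀ i x, (G i).mulVec x = g i x := fun i x => by
      simp only [G]; rw [LinearMap.toMatrix'_mulVec]; rfl
    refine Matrix.ext_of_mulVec_single fun x => ?_
    rw [← Matrix.mulVec_mulVec, ← Matrix.mulVec_mulVec, hGv, hGv, hg]
  have hG' : ∀ (i j : I) (a : i ⟶ j), (G j).map (algebraMap κ L) * (φ a).map (algebraMap κ L) =
      (ψ a).map (algebraMap κ L) * (G i).map (algebraMap κ L) := fun i j a => by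
    rw [← Matrix.map_mul, hG, Matrix.map_mul]
  refine ⟨fun i => Matrix.toLin'OfInv (M := (H i).map (algebraMap κ L))
    (M' := (G i).map (algebraMap κ L)) ?_ ?_, fun i j a x => ?_⟩
  · rw [← Matrix.map_mul, hHG]; simp
  · rw [← Matrix.map_mul, hGH]; simp
  · change ((G j).map (algebraMap κ L)).mulVec (((φ a).map (algebraMap κ L)).mulVec x) =
      ((ψ a).map (algebraMap κ L)).mulVec (((G i).map (algebraMap κ L)).mulVec x)
    rw [Matrix.mulVec_mulVec, Matrix.mulVec_mulVec, hG']

end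

/-- A representation can be written in the coordinates given by any choice of bases. -/
theorem Rep.exists_iso_of_equiv {V : I → Type} [∀ i, AddCommGroup (V i)] [∀ i, Module κ (V i)]
    {m : I → Type} [∀ i, Fintype (m i)] [∀ i, DecidableEq (m i)]
    (F : ∀ ⦃i j : I⦄, (i ⟶ j) → (V i →ₗ[κ] V j)) (b : ∀ i, V i ≃ₗ[κ] (m i → κ)) :
    ∃ ψ : Rep κ m, ∀ (i j : I) (a : i ⟶ j) x, b j (F a x) = (ψ a).mulVec (b i x) := by
  refine ⟨fun i j a => LinearMap.toMatrix' ((b j).toLinearMap ∘ₗ F a ∘ₗ (b i).symm.toLinearMap),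
    fun i j a x => ?_⟩
  rw [LinearMap.toMatrix'_mulVec]
  simp

theorem Rep.exists_iso_fin {n : I → Type} [∀ i, Fintype (n i)] (φ : Rep κ n) (v : I → ℕ)
    (hv : ∀ i, Fintype.card (n i) = v i) : ∃ ψ : Rep κ (fun i => Fin (v i)), ψ.Iso φ := by
  classical
  obtain ⟨ψ, hψ⟩ := Rep.exists_iso_of_equiv (V := fun i => n i → κ)
    (fun i j a => Matrix.mulVecLin (φ a))
    (fun i => LinearEquiv.funCongrLeft κ κ (Fintype.equivFinOfCardEq (hv i)).symm)
  exact ⟨ψ, Rep.Iso.symm ⟨_, hψ⟩⟩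

/-- The image and the kernel of an idempotent endomorphism are complementary subrepresentations;
conversely, the projection to a summand is an idempotent. Unlike decompositions, idempotents need no
choice of bases. -/
theorem Rep.indecomposable_iff {v : I → ℕ} (φ : Rep κ (fun i => Fin (v i))) :
    φ.Indecomposable ↔ v ≠ 0 ∧ φ.TrivialIdempotents := by
  refine and_congr_right fun hv => ⟨fun h e he hee => ?_, fun h v₁ v₂ φ₁ φ₂ hiso => ?_⟩
  · have hc : ∀ i, IsCompl (LinearMap.range (e i)) (LinearMap.ker (e i)) := fun i =>
      LinearMap.IsIdempotentElem.isCompl (f := e i) (LinearMap.ext (hee i))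
    have hr : ∀ (i j : I) (a : i ⟶ j) (x) (_ : x ∈ LinearMap.range (e i)),
        Matrix.mulVecLin (φ a) x ∈ LinearMap.range (e j) := by
      rintro i j a _ ⟨x, rfl⟩
      exact ⟨(φ a).mulVec x, he i j a x⟩
    have hk : ∀ (i j : I) (a : i ⟶ j) (x) (_ : x ∈ LinearMap.ker (e i)),
        Matrix.mulVecLin (φ a) x ∈ LinearMap.ker (e j) := by
      intro i j a x hx
      rw [LinearMap.mem_ker] at hx ⊢
      simp [he i j a x, hx]
    let v₁ : I → ℕ := fun i => Module.finrank κ (LinearMap.range (e i))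
    let v₂ : I → ℕ := fun i => Module.finrank κ (LinearMap.ker (e i))
    let b₁ : ∀ i, LinearMap.range (e i) ≃ₗ[κ] (Fin (v₁ i) → κ) := fun i =>
      (Module.finBasis κ (LinearMap.range (e i))).equivFun
    let b₂ : ∀ i, LinearMap.ker (e i) ≃ₗ[κ] (Fin (v₂ i) → κ) := fun i =>
      (Module.finBasis κ (LinearMap.ker (e i))).equivFun
    obtain ⟨φ₁, h₁⟩ := Rep.exists_iso_of_equiv (fun i j a => (Matrix.mulVecLin (φ a)).restrict (hr i j a)) b₁
    obtain ⟨φ₂, h₂⟩ := Rep.exists_iso_of_equiv (fun i j a => (Matrix.mulVecLin (φ a)).restrict (hk i j a)) b₂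
    have hiso : φ.Iso (φ₁.directSum φ₂) := by
      apply Rep.Iso.symm
      refine ⟨fun i => (LinearEquiv.sumArrowLequivProdArrow _ _ κ κ).trans
        ((((b₁ i).symm.prodCongr (b₂ i).symm)).trans (Submodule.prodEquivOfIsCompl _ _ (hc i))),
        fun i j a x => ?_⟩
      obtain ⟨x₁, hx₁⟩ := (b₁ i).surjective (x ∘ Sum.inl)
      obtain ⟨x₂, hx₂⟩ := (b₂ i).surjective (x ∘ Sum.inr)
      have hx : x = Sum.elim (b₁ i x₁) (b₂ i x₂) := by rw [hx₁, hx₂]; simp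
      have e1 := h₁ i j a x₁
      have e2 := h₂ i j a x₂
      have comp_inl : ∀ {α β : Type} (f : α → κ) (g : β → κ), LinearEquiv.sumArrowLequivProdArrow α β κ κ (Sum.elim f g) = (f, g) := fun f g => rfl
      simp only [Rep.directSum, hx, Matrix.fromBlocks_mulVec, Sum.elim_comp_inl, Sum.elim_comp_inr,
        Matrix.zero_mulVec, add_zero, zero_add, LinearEquiv.trans_apply, comp_inl, ← e1, ← e2,
        LinearEquiv.prodCongr_apply, LinearEquiv.symm_apply_apply]
      simp [Matrix.mulVec_add]
    refine (h v₁ v₂ φ₁ φ₂ hiso).imp (fun h0 i => ?_) (fun h0 i => ?_)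
    · exact LinearMap.range_eq_bot.mp (Submodule.finrank_eq_zero.mp (congrFun h0 i))
    · have hinj := LinearMap.ker_eq_bot.mp (Submodule.finrank_eq_zero.mp (congrFun h0 i))
      exact LinearMap.ext fun x => hinj (hee i x)
  · have h' := hiso.trivialIdempotents h
    have key := h' (fun i => Matrix.mulVecLin (Matrix.fromBlocks 1 0 0 0))
      (fun i j a x => by simp [Rep.directSum, Matrix.fromBlocks_multiply])
      (fun i x => by simp [Matrix.fromBlocks_multiply])
    refine key.imp (fun h0 => ?_) (fun h0 => ?_)
    · funext i
      by_contra hne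
      have := congrFun (LinearMap.congr_fun (h0 i) (fun _ => 1)) (Sum.inl ⟨0, Nat.pos_of_ne_zero hne⟩)
      simp [Matrix.fromBlocks_mulVec] at this
    · funext i
      by_contra hne
      have := congrFun (LinearMap.congr_fun (h0 i) (fun _ => 1)) (Sum.inr ⟨0, Nat.pos_of_ne_zero hne⟩)
      simp [Matrix.fromBlocks_mulVec] at this

end Homs

/-! ### Indecomposability forces spanning columns and injective legs -/

section Good

open Submodule

theorem disjoint_map_of_disjoint_comap {κ V W : Type} [Field κ] [AddCommGroup V] [Module κ V]
    [AddCommGroup W] [Module κ W] (f : V →ₗ[κ] W) {P : Submodule κ W} {C : Submodule κ V}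
    (h : Disjoint (P.comap f) C) : Disjoint (C.map f) P := by
  rw [Submodule.disjoint_def]
  rintro _ ⟨x, hx, rfl⟩ hx'
  rw [Submodule.disjoint_def.mp h x hx' hx, map_zero]

/-- In a chain of vector spaces `⋯ → V 1 → V 0`, the successive preimages of a subspace of `V 0`
have complements that are mapped into each other. -/
theorem exists_isCompl_chain {κ : Type} [Field κ] : ∀ (n : ℕ) (V : Fin (n + 1) → Type)
    [∀ j, AddCommGroup (V j)] [∀ j, Module κ (V j)]
    (f : ∀ j : Fin n, V j.succ →ₗ[κ] V j.castSucc) (P₀ : Submodule κ (V 0)),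
    ∃ P C : ∀ j, Submodule κ (V j), P 0 = P₀ ∧ (∀ j, IsCompl (P j) (C j)) ∧
      (∀ j : Fin n, P j.succ = (P j.castSucc).comap (f j)) ∧
      ∀ j : Fin n, C j.succ ≤ (C j.castSucc).comap (f j)
  | 0, V, _, _, f, P₀ => by
    obtain ⟨C₀, hC₀⟩ := ComplementedLattice.exists_isCompl P₀
    refine ⟨Fin.cases P₀ (fun j => j.elim0), Fin.cases C₀ (fun j => j.elim0), rfl,
      Fin.cases hC₀ (fun j => j.elim0), fun j => j.elim0, fun j => j.elim0⟩
  | n + 1, V, _, _, f, P₀ => by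
    -- Each complement must contain the image of the previous one, so they are built from the far
    -- end of the chain towards `V 0`.
    obtain ⟨P, C, h0, hc, hP, hC⟩ := exists_isCompl_chain n (fun j => V j.succ)
      (fun j => f j.succ) (P₀.comap (f 0))
    have hd : Disjoint ((C 0).map (f 0)) P₀ := disjoint_map_of_disjoint_comap _ (h0 ▸ (hc 0).disjoint)
    obtain ⟨C₀, hle, hC₀⟩ := hd.exists_isCompl
    refine ⟨Fin.cases P₀ P, Fin.cases C₀ C, rfl, Fin.cases hC₀.symm hc, Fin.cases h0 hP,
      Fin.cases (Submodule.map_le_iff_le_comap.mp hle) hC⟩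

theorem map_projection {κ V W : Type} [Field κ] [AddCommGroup V] [Module κ V] [AddCommGroup W]
    [Module κ W] (f : V →ₗ[κ] W) {p q : Submodule κ V} {p' q' : Submodule κ W}
    (h : IsCompl p q) (h' : IsCompl p' q') (hp : p ≤ p'.comap f) (hq : q ≤ q'.comap f) (x : V) :
    p'.projection q' h' (f x) = f (p.projection q h x) := by
  obtain ⟨y, hy, z, hz, rfl⟩ := Submodule.mem_sup.mp
    (show x ∈ p ⊔ q from h.sup_eq_top ▸ Submodule.mem_top)
  simp only [map_add]
  rw [projection_apply_of_mem_left h hy, projection_apply_of_mem_right h hz,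
    projection_apply_of_mem_left h' (hp hy), projection_apply_of_mem_right h' (hq hz)]
  simp

variable {r k : ℕ} {s : Fin k → ℕ} {κ : Type} [Field κ]

/-- The vector at `(i;0)` which is the image of the basis vector at `(l)`. -/
def Rep.col {n : Vertex r s → Type} [∀ x, Fintype (n x)] (φ : Rep κ n) (i : Fin k) (l : Fin r) :
    n (.long i 0) → κ :=
  (φ (Arrow.short l i : (.short l : Vertex r s) ⟶ .long i 0)).mulVec 1

/-- The map of the arrow `(i;j+1) ⟶ (i;j)`. -/
def Rep.legMap {n : Vertex r s → Type} [∀ x, Fintype (n x)] (φ : Rep κ n) (i : Fin k)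
    (j : Fin (s i)) : (n (.long i j.succ) → κ) →ₗ[κ] (n (.long i j.castSucc) → κ) :=
  (φ (Arrow.leg i j : (.long i j.succ : Vertex r s) ⟶ .long i j.castSucc)).mulVecLin

/-- The spaces at the short vertices are lines, so the intertwining condition there need only be
tested on the vector `1`. -/
theorem Rep.isHom_iff {n m : Vertex r s → Type} [∀ x, Fintype (n x)] [∀ x, Fintype (m x)]
    [∀ l, Unique (n (.short l))] {φ : Rep κ n} {ψ : Rep κ m}
    {g : ∀ i, (n i → κ) →ₗ[κ] (m i → κ)} {t : Fin r → κ} (ht : ∀ l, g (.short l) 1 = t l • 1) :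
    φ.IsHom ψ g ↔ (∀ i l, g (.long i 0) (φ.col i l) = t l • ψ.col i l) ∧
      ∀ i j x, g (.long i j.castSucc) (φ.legMap i j x) = ψ.legMap i j (g (.long i j.succ) x) := by
  constructor
  · intro h
    refine ⟨fun i l => ?_, fun i j x => h _ _ (Arrow.leg i j) x⟩
    rw [Rep.col, h _ _ (Arrow.short l i), ht, Matrix.mulVec_smul, Rep.col]
  · rintro ⟨h₁, h₂⟩ _ _ (⟨l, i⟩ | ⟨i, j⟩) x
    · have hx : x = x default • (1 : n (.short l) → κ) := by
        ext y; rw [Subsingleton.elim y default]; simp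
      rw [hx, Matrix.mulVec_smul, map_smul, map_smul, ht, Matrix.mulVec_smul, Matrix.mulVec_smul]
      exact congrArg _ (h₁ i l)
    · exact h₂ i j x

/-- The conditions on the maps of a representation under which it is given by flags. -/
def Rep.Good {n : Vertex r s → Type} [∀ x, Fintype (n x)] (φ : Rep κ n) : Prop :=
  (∀ i, Submodule.span κ (Set.range (φ.col i)) = ⊤) ∧ ∀ i j, Function.Injective (φ.legMap i j)

/-- A failure of either condition would split off a summand living on the long vertices only. The
chain of complements provides the projection. -/
theorem Rep.good_of_trivialIdempotents {n : Vertex r s → Type} [∀ x, Fintype (n x)]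
    [∀ l, Unique (n (.short l))] (hr : 0 < r) {φ : Rep κ n} (h : φ.TrivialIdempotents) :
    φ.Good := by
  constructor
  · intro i
    have := fun i => exists_isCompl_chain (s i) (fun j => n (.long i j) → κ) (φ.legMap i)
      (Submodule.span κ (Set.range (φ.col i)))
    choose P C h0 hc hP hC using this
    -- Projection to the subrepresentation of the vectors whose image at `(i;0)` lies in the span of
    -- the columns. It is the identity at the short vertices, hence everywhere.
    let e : ∀ x, (n x → κ) →ₗ[κ] (n x → κ) := fun x =>
      match x with
      | .short _ => LinearMap.id
      | .long i j => (P i j).projection (C i j) (hc i j)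
    have he : φ.IsHom φ e := by
      rw [Rep.isHom_iff (t := 1) (fun l => by simp [e])]
      refine ⟨fun i l => ?_, fun i j x => map_projection _ _ _ (hP i j).le (hC i j) x⟩
      rw [Pi.one_apply, one_smul]
      apply projection_apply_of_mem_left
      rw [h0]
      exact Submodule.subset_span ⟨l, rfl⟩
    have hee : ∀ x y, e x (e x y) = e x y := by
      rintro (l | ⟨i, j⟩) y
      · rfl
      · exact projection_apply_of_mem_left _ (projection_apply_mem _ _)
    obtain h' | h' := h e he hee
    · have := LinearMap.congr_fun (h' (.short ⟨0, hr⟩)) 1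
      exact absurd this one_ne_zero
    · rw [← h0, eq_top_iff]
      intro y _
      have := LinearMap.congr_fun (h' (.long i 0)) y
      rw [LinearMap.id_apply] at this
      rw [← this]
      exact projection_apply_mem _ _
  · intro i j
    have := fun i => exists_isCompl_chain (s i) (fun j => n (.long i j) → κ) (φ.legMap i) ⊥
    choose P C h0 hc hP hC using this
    -- Projection to the vectors that die on the way to `(i;0)`. It is zero at the short vertices,
    -- hence everywhere.
    let e : ∀ x, (n x → κ) →ₗ[κ] (n x → κ) := fun x =>
      match x with
      | .short _ => 0
      | .long i j => (P i j).projection (C i j) (hc i j)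
    have he : φ.IsHom φ e := by
      rw [Rep.isHom_iff (t := 0) (fun l => by simp [e])]
      refine ⟨fun i l => ?_, fun i j x => map_projection _ _ _ (hP i j).le (hC i j) x⟩
      rw [Pi.zero_apply, zero_smul]
      have := projection_apply_mem (hc i 0) (φ.col i l)
      exact (Submodule.mem_bot κ).mp ((h0 i).le this)
    have hee : ∀ x y, e x (e x y) = e x y := by
      rintro (l | ⟨i, j⟩) y
      · rfl
      · exact projection_apply_of_mem_left _ (projection_apply_mem _ _)
    obtain h' | h' := h e he hee
    · rw [← LinearMap.ker_eq_bot, eq_bot_iff]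
      intro y hy
      have hy' : y ∈ P i j.succ := by
        rw [hP, Submodule.mem_comap, LinearMap.mem_ker.mp hy]; exact zero_mem _
      have := LinearMap.congr_fun (h' (.long i j.succ)) y
      rw [show e (.long i j.succ) y = y from projection_apply_of_mem_left _ hy'] at this
      exact this
    · have := LinearMap.congr_fun (h' (.short ⟨0, hr⟩)) 1
      exact absurd this.symm one_ne_zero

end Good

/-! ### Normal forms: rigidity, torus action and the connectedness criterion -/

section NormalForm

variable {r k : ℕ} {s : Fin k → ℕ} {κ : Type} [Field κ]

/-- Whether `x` belongs to the basis at a vertex in the normal form with levels `a`. -/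
def LevelMem (a : Fin k → Fin r → ℕ) : Vertex r s → Fin r → Prop
  | .short l, x => x = l
  | .long i j, x => (j : ℕ) < a i x

instance (a : Fin k → Fin r → ℕ) : ∀ v : Vertex r s, DecidablePred (LevelMem a v)
  | .short l => fun x => inferInstanceAs (Decidable (x = l))
  | .long i j => fun x => inferInstanceAs (Decidable ((j : ℕ) < a i x))

/-- The index sets of the bases in the normal form of a representation with levels `a`. -/
abbrev LevelIndex (s : Fin k → ℕ) (a : Fin k → Fin r → ℕ) (v : Vertex r s) : Type :=
  {x : Fin r // LevelMem a v x}

instance (a : Fin k → Fin r → ℕ) (l : Fin r) : Unique (LevelIndex s a (.short l)) where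
  default := ⟨l, rfl⟩
  uniq x := Subtype.ext x.2

/-- The parameters `u` of a normal form with levels `a` live on the inversions of `a`. -/
structure Levelled (s : Fin k → ℕ) (a : Fin k → Fin r → ℕ) (u : Fin k × Fin r × Fin r → κ) :
    Prop where
  le (i x) : a i x ≤ s i + 1
  lt {i y x} : u (i, y, x) ≠ 0 → y < x
  level_lt {i y x} : u (i, y, x) ≠ 0 → a i y < a i x

/-- The normal form with levels `a` and parameters `u`. -/
def normalForm (s : Fin k → ℕ) (a : Fin k → Fin r → ℕ) (u : Fin k × Fin r × Fin r → κ) :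
    Rep κ (LevelIndex s a)
  | _, _, .short l i => fun x _ =>
      (if x.1 = l then 1 else 0) + if a i l = 0 then u (i, l, x.1) else 0
  | _, _, .leg i j => fun y x =>
      (if y.1 = x.1 then 1 else 0) + if a i y.1 = j + 1 then u (i, y.1, x.1) else 0

variable {a a' : Fin k → Fin r → ℕ} {u u' : Fin k × Fin r × Fin r → κ}

theorem normalForm_col (i : Fin k) (l : Fin r) (x : LevelIndex s a (.long i 0)) :
    (normalForm s a u).col i l x =
      (if x.1 = l then 1 else 0) + if a i l = 0 then u (i, l, x.1) else 0 := by
  simp only [Rep.col, Matrix.mulVec, dotProduct, Pi.one_apply, mul_one, Fintype.sum_unique]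
  rfl

theorem normalForm_col_of_pos (i : Fin k) (l : Fin r) (hl : 0 < a i l)
    (x : LevelIndex s a (.long i 0)) :
    (normalForm s a u).col i l x = if x.1 = l then 1 else 0 := by
  rw [normalForm_col, if_neg hl.ne', add_zero]

theorem normalForm_col_of_eq (i : Fin k) (l : Fin r) (hl : a i l = 0)
    (x : LevelIndex s a (.long i 0)) : (normalForm s a u).col i l x = u (i, l, x.1) := by
  rw [normalForm_col, if_neg, if_pos hl, zero_add]
  intro h
  have : 0 < a i x.1 := x.2
  rw [h] at this
  omega

theorem normalForm_legMap (i : Fin k) (j : Fin (s i)) (h : LevelIndex s a (.long i j.succ) → κ)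
    (y : LevelIndex s a (.long i j.castSucc)) :
    (normalForm s a u).legMap i j h y = ∑ x : LevelIndex s a (.long i j.succ),
      ((if y.1 = x.1 then 1 else 0) + if a i y.1 = j + 1 then u (i, y.1, x.1) else 0) * h x := rfl

theorem normalForm_legMap_of_lt (i : Fin k) (j : Fin (s i))
    (h : LevelIndex s a (.long i j.succ) → κ) (y : LevelIndex s a (.long i j.castSucc))
    (z : LevelIndex s a (.long i j.succ)) (hz : y.1 = z.1) :
    (normalForm s a u).legMap i j h y = h z := by
  have hz' : (j : ℕ) + 1 < a i z.1 := z.2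
  rw [normalForm_legMap, Finset.sum_eq_single z]
  · rw [if_pos hz, hz, if_neg (by omega)]; simp
  · intro x _ hx
    rw [if_neg (fun h => hx (Subtype.ext (h.symm.trans hz))), hz, if_neg (by omega)]; simp
  · simp

theorem normalForm_legMap_of_eq (i : Fin k) (j : Fin (s i))
    (h : LevelIndex s a (.long i j.succ) → κ) (y : LevelIndex s a (.long i j.castSucc))
    (hy : a i y.1 = j + 1) : (normalForm s a u).legMap i j h y =
      ∑ x : LevelIndex s a (.long i j.succ), u (i, y.1, x.1) * h x := by
  rw [normalForm_legMap]
  refine Finset.sum_congr rfl fun x _ => ?_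
  have hx : (j : ℕ) + 1 < a i x.1 := x.2
  rw [if_pos hy, if_neg, zero_add]
  intro h
  rw [h] at hy
  omega

theorem LevelMem.of_succ {i : Fin k} {j : Fin (s i)} {x : Fin r}
    (h : LevelMem a (.long i j.succ : Vertex r s) x) :
    LevelMem a (.long i j.castSucc : Vertex r s) x :=
  lt_trans (Nat.lt_succ_self _) h

/-- A homomorphism between normal forms is diagonal where the levels agree. -/
theorem isHom_normalForm_apply {g : ∀ v, (LevelIndex s a v → κ) →ₗ[κ] (LevelIndex s a' v → κ)}
    {t : Fin r → κ} (ht : ∀ l, g (.short l) 1 = t l • 1)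
    (hg : (normalForm s a u).IsHom (normalForm s a' u') g) (i : Fin k) (j : Fin (s i + 1))
    (haa : ∀ x, ∀ j' ≤ (j : ℕ), j' < a i x ↔ j' < a' i x)
    (h : LevelIndex s a (.long i j) → κ) (y : LevelIndex s a (.long i j))
    (y' : LevelIndex s a' (.long i j)) (hy : y.1 = y'.1) :
    g (.long i j) h y' = t y.1 * h y := by
  obtain ⟨hc, hl⟩ := (Rep.isHom_iff ht).mp hg
  induction j using Fin.induction with
  | zero =>
    -- At `(i;0)` the columns of positive level are the standard basis vectors, and `g` multiplies
    -- the column `l` by `t l`.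
    have : LinearMap.proj (φ := fun _ => κ) y' ∘ₗ g (.long i 0) =
        t y.1 • LinearMap.proj (φ := fun _ => κ) y := by
      refine LinearMap.pi_ext' fun x => LinearMap.ext_ring ?_
      have hxa : 0 < a i x.1 := x.2
      have hx' : (normalForm s a u).col i x.1 = Pi.single x 1 := by
        funext z
        rw [normalForm_col_of_pos _ _ hxa, Pi.single_apply]
        exact if_congr Subtype.ext_iff.symm rfl rfl
      have := congrFun (hc i x.1) y'
      rw [hx', Pi.smul_apply, normalForm_col_of_pos _ _ ((haa x.1 0 (by simp)).mp hxa)] at this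
      refine this.trans ?_
      change t x.1 * _ = t y.1 * (Pi.single (M := fun _ => κ) x 1 y)
      rw [Pi.single_apply, ← hy]
      by_cases hyx : y = x
      · subst hyx; simp
      · rw [if_neg hyx, if_neg (fun h => hyx (Subtype.ext h)), mul_zero, mul_zero]
    exact LinearMap.congr_fun this h
  | succ j ih =>
    -- A coordinate that survives at `(i;j+1)` is the restriction of the same coordinate at `(i;j)`.
    have := congrFun (hl i j h) ⟨y'.1, y'.2.of_succ⟩
    rw [normalForm_legMap_of_lt _ _ _ _ y' rfl,
      ih (fun x j' hj' => haa x j' (by simp at hj' ⊢; omega)) _ ⟨y.1, y.2.of_succ⟩ _ hy,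
      normalForm_legMap_of_lt _ _ _ _ y rfl] at this
    exact this.symm

/-- If `a' i l = 0`, the column `l` of the target is a combination of later columns. Injectivity
carries this relation back to the source, where it fails in the coordinate `l`: column `l` has a `1`
there and later columns have `0`. -/
theorem level_pos_of_isHom {g : ∀ v, (LevelIndex s a v → κ) →ₗ[κ] (LevelIndex s a' v → κ)}
    {t : Fin r → κ} (ht : ∀ l, g (.short l) 1 = t l • 1) (ht0 : ∀ l, t l ≠ 0)
    (hg : (normalForm s a u).IsHom (normalForm s a' u') g)
    (hu : Levelled s a u) (hu' : Levelled s a' u') (i : Fin k)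
    (hinj : Function.Injective (g (.long i 0))) (l : Fin r) (hl : 0 < a i l) : 0 < a' i l := by
  by_contra hl'
  replace hl' : a' i l = 0 := by omega
  obtain ⟨hc, -⟩ := (Rep.isHom_iff ht).mp hg
  have h1 : (normalForm s a u).col i l =
      ∑ x : LevelIndex s a' (.long i 0),
        (t l * u' (i, l, x.1) * (t x.1)⁻¹) • (normalForm s a u).col i x.1 := by
    apply hinj
    rw [hc, map_sum]
    simp only [map_smul, hc]
    funext z
    rw [Pi.smul_apply, normalForm_col_of_eq _ _ hl', Finset.sum_apply, Finset.sum_eq_single z]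
    · have hz : 0 < a' i z.1 := z.2
      rw [Pi.smul_apply, Pi.smul_apply, normalForm_col_of_pos _ _ hz, if_pos rfl, smul_smul,
        mul_assoc, inv_mul_cancel₀ (ht0 z.1)]
      simp
    · intro x _ hne
      have hx : 0 < a' i x.1 := x.2
      rw [Pi.smul_apply, Pi.smul_apply, normalForm_col_of_pos _ _ hx,
        if_neg (fun h => hne (Subtype.ext h.symm))]
      simp
    · simp
  have h2 := congrFun h1 ⟨l, hl⟩
  rw [normalForm_col_of_pos _ _ hl, if_pos rfl, Finset.sum_apply, Finset.sum_eq_zero] at h2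
  · simp at h2
  · intro x _
    rw [Pi.smul_apply, normalForm_col]
    by_cases h : u' (i, l, x.1) = 0
    · simp [h]
    · have hlx := hu'.lt h
      have : u (i, x.1, l) = 0 := by
        by_contra h'
        exact lt_asymm hlx (hu.lt h')
      simp [hlx.ne, this]

/-- The dual argument, with coordinate functions instead of columns. If the coordinate `y` left the
target at this step, it would be a combination of later coordinates on the next space. The image of
the basis vector at `y` has later coordinates zero, yet its coordinate `y` is `t y ≠ 0`. -/
theorem level_lt_of_isHom {g : ∀ v, (LevelIndex s a v → κ) →ₗ[κ] (LevelIndex s a' v → κ)}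
    {t : Fin r → κ} (ht : ∀ l, g (.short l) 1 = t l • 1) (ht0 : ∀ l, t l ≠ 0)
    (hg : (normalForm s a u).IsHom (normalForm s a' u') g)
    (hu : Levelled s a u) (hu' : Levelled s a' u') (i : Fin k) (j : Fin (s i))
    (haa : ∀ x, ∀ j' ≤ (j : ℕ), j' < a i x ↔ j' < a' i x)
    (y : Fin r) (hy : (j : ℕ) + 1 < a i y) : (j : ℕ) + 1 < a' i y := by
  by_contra hy'
  obtain ⟨-, hl⟩ := (Rep.isHom_iff ht).mp hg
  have hyj' : (j : ℕ) < a' i y := (haa y j le_rfl).mp (by omega)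
  let Y : LevelIndex s a (.long i j.succ) := ⟨y, hy⟩
  let h : LevelIndex s a (.long i j.succ) → κ := Pi.single Y 1
  have key : ∀ (x : LevelIndex s a (.long i j.castSucc)) (x' : LevelIndex s a' (.long i j.castSucc)),
      x.1 = x'.1 → (normalForm s a' u').legMap i j (g (.long i j.succ) h) x' =
        t x.1 * (normalForm s a u).legMap i j h x := fun x x' hx => by
    rw [← hl i j h]
    exact isHom_normalForm_apply ht hg i j.castSucc haa _ x x' hx
  have h1 := key ⟨y, Y.2.of_succ⟩ ⟨y, hyj'⟩ rfl
  rw [normalForm_legMap_of_eq (hy := show a' i y = _ by omega),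
    normalForm_legMap_of_lt _ _ _ _ Y rfl, Finset.sum_eq_zero] at h1
  · refine ht0 y ?_
    rw [show h Y = 1 from Pi.single_eq_same _ _, mul_one] at h1
    exact h1.symm
  · intro x _
    by_cases hux : u' (i, y, x.1) = 0
    · change u' (i, y, x.1) * _ = 0
      rw [hux, zero_mul]
    have hyx := hu'.lt hux
    have hx1 : (j : ℕ) < a i x.1 := (haa x.1 j le_rfl).mpr x.2.of_succ
    have h2 := key ⟨x.1, hx1⟩ ⟨x.1, x.2.of_succ⟩ rfl
    rw [normalForm_legMap_of_lt _ _ _ _ x rfl, normalForm_legMap, Finset.sum_eq_single Y] at h2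
    · have : u (i, x.1, y) = 0 := by
        by_contra h'
        exact lt_asymm hyx (hu.lt h')
      rw [h2]
      simp [Y, hyx.ne', this]
    · intro z _ hz
      rw [show h z = 0 from Pi.single_eq_of_ne hz _, mul_zero]
    · simp

theorem exists_scalar {n m : Type} [Unique n] [Unique m]
    (g : (n → κ) →ₗ[κ] (m → κ)) : ∃ t : κ, g 1 = t • 1 :=
  ⟨g 1 default, by ext y; rw [Subsingleton.elim y default]; simp⟩

theorem exists_units_scalar {n m : Vertex r s → Type} [∀ l, Unique (n (.short l))]
    [∀ l, Unique (m (.short l))] (g : ∀ v, (n v → κ) ≃ₗ[κ] (m v → κ)) :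
    ∃ t : Fin r → κ, (∀ l, (g (.short l)).toLinearMap 1 = t l • 1) ∧ ∀ l, t l ≠ 0 := by
  choose t ht using fun l => exists_scalar (g (.short l)).toLinearMap
  refine ⟨t, ht, fun l h0 => ?_⟩
  have := ht l
  rw [h0, zero_smul] at this
  exact one_ne_zero ((g (.short l)).map_eq_zero_iff.mp this)

/-- The levels of a normal form are determined by its isomorphism class. -/
theorem levels_eq_of_iso (hu : Levelled s a u) (hu' : Levelled s a' u')
    (h : (normalForm s a u).Iso (normalForm s a' u')) : a = a' := by
  obtain ⟨g', hg'⟩ := h.symm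
  obtain ⟨g, hg⟩ := h
  obtain ⟨t, ht, ht0⟩ := exists_units_scalar g
  obtain ⟨t', ht', ht0'⟩ := exists_units_scalar g'
  -- Induction along the leg, since comparing one level uses diagonality at the vertices before it.
  -- The inverse isomorphism gives the converse implications.
  have key : ∀ i (m : ℕ), m ≤ s i → ∀ x, ∀ j ≤ m, j < a i x ↔ j < a' i x := by
    intro i m
    induction m with
    | zero =>
      intro _ x j hj
      obtain rfl : j = 0 := by omega
      exact ⟨level_pos_of_isHom ht ht0 hg hu hu' i (g _).injective x,
        level_pos_of_isHom ht' ht0' hg' hu' hu i (g' _).injective x⟩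
    | succ m ih =>
      intro hm x j hj
      obtain hj | rfl := Nat.le_succ_iff.mp hj
      · exact ih (by omega) x j hj
      · exact ⟨level_lt_of_isHom ht ht0 hg hu hu' i ⟨m, hm⟩ (ih (by omega)) x,
          level_lt_of_isHom ht' ht0' hg' hu' hu i ⟨m, hm⟩
            (fun x j hj => (ih (by omega) x j hj).symm) x⟩
  funext i x
  have h1 := hu.le i x
  have h2 := hu'.le i x
  have h3 := key i (s i) le_rfl x
  obtain hlt | heq | hlt := lt_trichotomy (a i x) (a' i x)
  · exact absurd ((h3 (a i x) (by omega)).mpr hlt) (lt_irrefl _)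
  · exact heq
  · exact absurd ((h3 (a' i x) (by omega)).mp hlt) (lt_irrefl _)

/-- How the parameters of two normal forms are related by the diagonal matrix `t`. -/
def ScaledBy (a : Fin k → Fin r → ℕ) (t : Fin r → κ) (u u' : Fin k × Fin r × Fin r → κ) : Prop :=
  ∀ i y x, if a i y = 0 then t x * u (i, y, x) = t y * u' (i, y, x)
    else t y * u (i, y, x) = t x * u' (i, y, x)

/-- A parameter with `a i y = 0` is an entry of a column, any other one an entry of a leg map. The
two kinds scale in opposite directions because `y` indexes the source in the first case and the
target in the second. -/
theorem scaledBy_of_isHom {g : ∀ v, (LevelIndex s a v → κ) →ₗ[κ] (LevelIndex s a v → κ)}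
    {t : Fin r → κ} (ht : ∀ l, g (.short l) 1 = t l • 1)
    (hg : (normalForm s a u).IsHom (normalForm s a u') g)
    (hu : Levelled s a u) (hu' : Levelled s a u') : ScaledBy a t u u' := by
  intro i y x
  by_cases h0 : u (i, y, x) = 0 ∧ u' (i, y, x) = 0
  · simp [h0.1, h0.2]
  have hyx : y < x ∧ a i y < a i x := by
    by_cases h : u (i, y, x) = 0
    · have := fun h' => h0 ⟨h, h'⟩
      exact ⟨hu'.lt this, hu'.level_lt this⟩
    · exact ⟨hu.lt h, hu.level_lt h⟩
  have hd : ∀ j h (z : LevelIndex s a (.long i j)), g (.long i j) h z = t z.1 * h z :=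
    fun j h z => isHom_normalForm_apply ht hg i j (fun _ _ _ => Iff.rfl) h z z rfl
  obtain ⟨hc, hl⟩ := (Rep.isHom_iff ht).mp hg
  split_ifs with hy
  · have hx : 0 < a i x := by omega
    have := congrFun (hc i y) ⟨x, hx⟩
    rw [hd, Pi.smul_apply, normalForm_col_of_eq _ _ hy, normalForm_col_of_eq _ _ hy] at this
    exact this
  · obtain ⟨j, hj⟩ := Nat.exists_eq_add_one_of_ne_zero hy
    have hjs : j < s i := by have := hu.le i x; omega
    let J : Fin (s i) := ⟨j, hjs⟩
    let Z : LevelIndex s a (.long i J.succ) := ⟨x, show j + 1 < a i x by omega⟩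
    let Y : LevelIndex s a (.long i J.castSucc) := ⟨y, show j < a i y by omega⟩
    have := congrFun (hl i J (Pi.single Z 1)) Y
    rw [hd, normalForm_legMap_of_eq _ _ _ _ hj, normalForm_legMap_of_eq _ _ _ _ hj,
      Finset.sum_eq_single Z, Finset.sum_eq_single Z, hd] at this
    · simpa [Z, Y, mul_comm] using this
    · intro z _ hz
      rw [hd, Pi.single_eq_of_ne hz, mul_zero, mul_zero]
    · simp
    · intro z _ hz
      rw [Pi.single_eq_of_ne hz, mul_zero]
    · simp

/-- The diagonal map with entries `t`. -/
def diagonal (s : Fin k → ℕ) (a : Fin k → Fin r → ℕ) (t : Fin r → κ) (v : Vertex r s) :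
    (LevelIndex s a v → κ) →ₗ[κ] (LevelIndex s a v → κ) :=
  LinearMap.pi fun x => t x.1 • LinearMap.proj x

theorem diagonal_apply (t : Fin r → κ) (v : Vertex r s) (h : LevelIndex s a v → κ)
    (x : LevelIndex s a v) : diagonal s a t v h x = t x.1 * h x := rfl

theorem diagonal_short (t : Fin r → κ) (l : Fin r) : diagonal s a t (.short l) 1 = t l • 1 := by
  funext x
  rw [diagonal_apply, show x.1 = l from x.2]
  rfl

theorem ScaledBy.isHom_diagonal {t : Fin r → κ} (h : ScaledBy a t u u') :
    (normalForm s a u).IsHom (normalForm s a u') (diagonal s a t) := by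
  rw [Rep.isHom_iff (t := t) (fun l => diagonal_short t l)]
  refine ⟨fun i l => ?_, fun i j f => ?_⟩
  · funext x
    rw [diagonal_apply, Pi.smul_apply, smul_eq_mul]
    have hx := h i l x.1
    by_cases hl : a i l = 0
    · rw [if_pos hl] at hx
      rw [normalForm_col_of_eq _ _ hl, normalForm_col_of_eq _ _ hl, hx]
    · rw [normalForm_col_of_pos _ _ (Nat.pos_of_ne_zero hl),
        normalForm_col_of_pos _ _ (Nat.pos_of_ne_zero hl)]
      split_ifs with hxl
      · rw [hxl]
      · simp
  · funext y
    rw [diagonal_apply]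
    by_cases hy' : (j : ℕ) + 1 < a i y.1
    · rw [normalForm_legMap_of_lt _ _ _ _ ⟨y.1, hy'⟩ rfl,
        normalForm_legMap_of_lt _ _ _ _ ⟨y.1, hy'⟩ rfl, diagonal_apply]
    · have hy : (j : ℕ) < a i y.1 := y.2
      have hj : a i y.1 = j + 1 := by omega
      rw [normalForm_legMap_of_eq _ _ _ _ hj, normalForm_legMap_of_eq _ _ _ _ hj, Finset.mul_sum]
      refine Finset.sum_congr rfl fun x _ => ?_
      have := h i y.1 x.1
      rw [if_neg (by omega)] at this
      rw [diagonal_apply, ← mul_assoc, this]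
      ring

theorem ScaledBy.iso {t : Fin r → κ} (h : ScaledBy a t u u') (ht : ∀ x, t x ≠ 0) :
    (normalForm s a u).Iso (normalForm s a u') := by
  refine ⟨fun v => LinearEquiv.ofLinearMap (diagonal s a t v) (diagonal s a (fun x => (t x)⁻¹) v) ?_ ?_,
    h.isHom_diagonal⟩
  all_goals
    apply LinearMap.ext
    intro f
    funext x
    rw [LinearMap.comp_apply, diagonal_apply, diagonal_apply]
    simp [ht x.1]

theorem SimpleGraph.Connected.eq_of_forall_adj {V α : Type*} {G : SimpleGraph V} (hG : G.Connected)
    (f : V → α) (h : ∀ x y, G.Adj x y → f x = f y) (x y : V) : f x = f y := by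
  obtain ⟨p⟩ := hG.preconnected x y
  induction p with
  | nil => rfl
  | cons hadj _ ih => exact (h _ _ hadj).trans ih

open Classical in
/-- The set of edges where the parameters do not vanish. -/
noncomputable def edgeSupport (u : Fin k × Fin r × Fin r → κ) : Finset (Fin k × Fin r × Fin r) :=
  Finset.univ.filter fun e => u e ≠ 0

theorem mem_edgeSupport {e : Fin k × Fin r × Fin r} : e ∈ edgeSupport u ↔ u e ≠ 0 := by
  simp [edgeSupport]

theorem eq_of_isConnectedSpanning {α : Type*} (h : IsConnectedSpanning (edgeSupport u)) (t : Fin r → α)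
    (ht : ∀ i y x, u (i, y, x) ≠ 0 → t y = t x) (x y : Fin r) : t x = t y := by
  refine SimpleGraph.Connected.eq_of_forall_adj h t (fun x y hxy => ?_) x y
  rw [SimpleGraph.fromRel_adj] at hxy
  obtain ⟨-, ⟨i, hi⟩ | ⟨i, hi⟩⟩ := hxy
  · exact ht i x y (by simpa [edgeSupport] using hi)
  · exact (ht i y x (by simpa [edgeSupport] using hi)).symm

theorem ScaledBy.eq_on_edges {t : Fin r → κ} (h : ScaledBy a t u u) (i y x) (he : u (i, y, x) ≠ 0) :
    t y = t x := by
  have := h i y x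
  split_ifs at this
  · exact (mul_right_cancel₀ he this).symm
  · exact mul_right_cancel₀ he this

/-- Endomorphisms are diagonal, with entries constant along the edges of the support. Indicators of
components are idempotents, and on a connected graph only scalars remain. -/
theorem trivialIdempotents_normalForm_iff (hr : 0 < r) (hu : Levelled s a u) :
    (normalForm s a u).TrivialIdempotents ↔ IsConnectedSpanning (edgeSupport u) := by
  classical
  constructor
  · intro h
    have : Nonempty (Fin r) := ⟨⟨0, hr⟩⟩
    refine SimpleGraph.Connected.mk fun x y => ?_
    set G := SimpleGraph.fromRel fun j i : Fin r => ∃ t, (t, j, i) ∈ edgeSupport u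
    let t : Fin r → κ := fun z => if G.Reachable x z then 1 else 0
    have ht : ∀ i y x, u (i, y, x) ≠ 0 → t y = t x := fun i z z' hz => by
      have hadj : G.Adj z z' := by
        rw [SimpleGraph.fromRel_adj]
        exact ⟨(hu.lt hz).ne, Or.inl ⟨i, by simpa [edgeSupport] using hz⟩⟩
      exact if_congr ⟨fun h => h.trans hadj.reachable, fun h => h.trans hadj.symm.reachable⟩ rfl rfl
    have hs : ScaledBy a t u u := fun i y x => by
      by_cases he : u (i, y, x) = 0
      · simp [he]
      · simp [ht i y x he]
    have := h (diagonal s a t) hs.isHom_diagonal fun v f => by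
      funext x
      rw [diagonal_apply, diagonal_apply]
      simp only [t]
      split_ifs <;> simp
    obtain h0 | h1 := this
    · have h2 := congrFun (LinearMap.congr_fun (h0 (.short x)) 1) default
      rw [diagonal_short] at h2
      simp [t] at h2
    · have h2 := congrFun (LinearMap.congr_fun (h1 (.short y)) 1) default
      rw [diagonal_short] at h2
      by_contra hxy
      simp [t, hxy] at h2
  · intro h e he hee
    choose t ht using fun l => exists_scalar (e (.short l))
    have hs := scaledBy_of_isHom ht he hu hu
    have hcon := eq_of_isConnectedSpanning h t hs.eq_on_edges
    have hd : ∀ v f z, e v f z = t ⟨0, hr⟩ * f z := by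
      rintro (l | ⟨i, j⟩) f z
      · have hf : f = f default • 1 := by
          funext y; rw [Subsingleton.elim y default]; simp
        rw [hf, map_smul, ht, hcon l ⟨0, hr⟩]
        simp [mul_comm]
      · rw [isHom_normalForm_apply ht he i j (fun _ _ _ => Iff.rfl) f z z rfl, hcon z.1 ⟨0, hr⟩]
    have h2 := congrFun (hee (.short ⟨0, hr⟩) 1) default
    rw [hd, hd] at h2
    simp only [Pi.one_apply, mul_one] at h2
    obtain h0 | h1 : t ⟨0, hr⟩ = 0 ∨ t ⟨0, hr⟩ = 1 := by
      rcases eq_or_ne (t ⟨0, hr⟩) 0 with h | h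
      · exact Or.inl h
      · exact Or.inr (mul_left_cancel₀ h (by rw [h2, mul_one]))
    · refine Or.inl fun v => LinearMap.ext fun f => funext fun z => ?_
      rw [hd, h0, zero_mul]; rfl
    · refine Or.inr fun v => LinearMap.ext fun f => funext fun z => ?_
      rw [hd, h1, one_mul]; rfl

theorem normalForm_baseChange (L : Type) [Field L] [Algebra κ L] :
    (normalForm s a u).baseChange L = normalForm s a (fun e => algebraMap κ L (u e)) := by
  funext x y e
  obtain ⟨l, i⟩ | ⟨i, j⟩ := e
  all_goals
    funext z z'
    simp only [Rep.baseChange, normalForm]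
    change algebraMap κ L (_ + _) = _
    rw [map_add]
    congr 1 <;> split_ifs <;> simp

/-- Base change keeps the normal form and the support of its parameters, so the criterion is the
same over every extension. -/
theorem absolutelyIndecomposable_iff (hr : 0 < r) (hu : Levelled s a u) {v : Vertex r s → ℕ}
    (hv : v ≠ 0) {φ : Rep κ (fun i => Fin (v i))} (h : φ.Iso (normalForm s a u)) :
    φ.AbsolutelyIndecomposable ↔ IsConnectedSpanning (edgeSupport u) := by
  constructor
  · rintro ⟨h', -⟩
    rw [Rep.indecomposable_iff] at h'
    exact (trivialIdempotents_normalForm_iff hr hu).mp (h.trivialIdempotents h'.2)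
  · intro hc
    have hi : φ.Indecomposable := (Rep.indecomposable_iff φ).mpr
      ⟨hv, h.symm.trivialIdempotents ((trivialIdempotents_normalForm_iff hr hu).mpr hc)⟩
    refine ⟨hi, fun L _ _ _ => ?_⟩
    have hL : Levelled s a (fun e => algebraMap κ L (u e)) :=
      ⟨hu.le, fun h => hu.lt (by simpa using h), fun h => hu.level_lt (by simpa using h)⟩
    have hsupp : edgeSupport (fun e => algebraMap κ L (u e)) = edgeSupport u := by
      ext e
      simp [edgeSupport]
    have := (trivialIdempotents_normalForm_iff hr hL).mpr (by rwa [hsupp])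
    rw [← normalForm_baseChange] at this
    exact (Rep.indecomposable_iff _).mpr ⟨hv, (h.baseChange L).symm.trivialIdempotents this⟩

end NormalForm

/-! ### Existence of normal forms by elimination -/

section Existence

variable {r k : ℕ} {s : Fin k → ℕ} {κ : Type} [Field κ]

theorem sum_eq_sum_subtype {ι M : Type*} [Fintype ι] [AddCommMonoid M] (p : ι → Prop)
    [Fintype {x // p x}] {f : ι → M} (hf : ∀ x, ¬ p x → f x = 0) :
    ∑ x, f x = ∑ x : {x // p x}, f x := by
  classical
  rw [← Finset.sum_filter_of_ne (p := p) fun x _ hx => not_not.mp fun h => hx (hf x h)]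
  exact Finset.sum_subtype _ (by simp) _

/-- Among the members of a finite spanning family, those not in the span of later ones form a
basis, and the other ones are combinations of later basis vectors. -/
theorem exists_basis_of_span_eq_top {V : Type} [AddCommGroup V] [Module κ V] (ρ : Fin r → V)
    (hρ : Submodule.span κ (Set.range ρ) = ⊤) :
    ∃ (p : Fin r → Prop) (b : Module.Basis {x // p x} κ V) (c : Fin r → Fin r → κ),
      (∀ x, b x = ρ x) ∧ (∀ y x, c y x ≠ 0 → y < x ∧ p x ∧ ¬ p y) ∧
        ∀ y, ¬ p y → ρ y = ∑ x, c y x • ρ x := by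
  classical
  let p : Fin r → Prop := fun y => ρ y ∉ Submodule.span κ (ρ '' {z | y < z})
  have hli : LinearIndependent κ (fun x : {x // p x} => ρ x) := by
    rw [Fintype.linearIndependent_iff]
    intro g hg
    by_contra! hne
    -- In a relation, the member with the smallest index is a combination of later ones, which `p`
    -- forbids.
    obtain ⟨x, hx, hmin⟩ := WellFounded.has_min (wellFounded_lt (α := {x // p x}))
      {x | g x ≠ 0} hne
    apply x.2
    rw [← Finset.add_sum_erase _ _ (Finset.mem_univ x)] at hg
    have : ρ x = -(g x)⁻¹ • ∑ z ∈ Finset.univ.erase x, g z • ρ z := by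
      rw [← sub_eq_zero, neg_smul, sub_neg_eq_add, ← smul_eq_zero_iff_right (r := g x) hx, smul_add,
        smul_inv_smul₀ hx, hg]
    rw [this]
    refine Submodule.smul_mem _ _ (Submodule.sum_mem _ fun z hz => ?_)
    by_cases h0 : g z = 0
    · rw [h0, zero_smul]; exact zero_mem _
    · refine Submodule.smul_mem _ _ (Submodule.subset_span ⟨z, ?_, rfl⟩)
      exact lt_of_le_of_ne (not_lt.mp (hmin z h0)) (fun h => (Finset.mem_erase.mp hz).1 h.symm)
  have hspan : ∀ y, ρ y ∈ Submodule.span κ (ρ '' {x | p x ∧ y ≤ x}) := by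
    intro y
    induction y using WellFoundedGT.induction with
    | ind y ih =>
      by_cases hy : p y
      · exact Submodule.subset_span ⟨y, ⟨hy, le_rfl⟩, rfl⟩
      · refine Submodule.span_le.mpr ?_ (not_not.mp hy)
        rintro _ ⟨z, hz, rfl⟩
        exact Submodule.span_mono (Set.image_mono (s := {x | p x ∧ z ≤ x}) (t := {x | p x ∧ y ≤ x})
          fun x hx => ⟨hx.1, le_trans (le_of_lt hz) hx.2⟩) (ih z hz)
  have hspan' : ∀ y, ¬ p y → ρ y ∈ Submodule.span κ (ρ '' {x | p x ∧ y < x}) := by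
    intro y hy
    have := hspan y
    exact Submodule.span_mono (Set.image_mono (s := {x | p x ∧ y ≤ x}) (t := {x | p x ∧ y < x}) fun x hx =>
      ⟨hx.1, lt_of_le_of_ne hx.2 (fun h => hy (h ▸ hx.1))⟩) this
  let b : Module.Basis {x // p x} κ V := Module.Basis.mk hli (by
    rw [← hρ, Submodule.span_le]
    rintro _ ⟨y, rfl⟩
    refine Submodule.span_mono ?_ (hspan y)
    rintro _ ⟨x, hx, rfl⟩
    exact ⟨⟨x, hx.1⟩, rfl⟩)
  have hb : ∀ x, b x = ρ x := fun x => Module.Basis.mk_apply _ _ x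
  refine ⟨p, b, fun y x => if h : p x ∧ ¬ p y then b.repr (ρ y) ⟨x, h.1⟩ else 0, hb, ?_, ?_⟩
  · intro y x hxy
    by_cases h : p x ∧ ¬ p y
    · refine ⟨?_, h⟩
      replace hxy : b.repr (ρ y) ⟨x, h.1⟩ ≠ 0 := fun h0 => hxy ((dif_pos h).trans h0)
      have hm : ρ y ∈ Submodule.span κ (b '' {x | y < x.1}) := by
        refine Submodule.span_mono ?_ (hspan' y h.2)
        rintro _ ⟨x, hx, rfl⟩
        exact ⟨⟨x, hx.1⟩, hx.2, hb _⟩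
      rw [Module.Basis.mem_span_image] at hm
      exact hm (Finsupp.mem_support_iff.mpr hxy)
    · exact absurd (dif_neg h) hxy
  · intro y hy
    conv_lhs => rw [← b.sum_repr (ρ y)]
    rw [sum_eq_sum_subtype p (fun x hx => by
      dsimp only
      rw [dif_neg (fun h => hx h.1), zero_smul])]
    refine Finset.sum_congr rfl fun x _ => ?_
    dsimp only
    rw [hb, dif_pos (And.intro x.2 hy)]

/-- A chain of subspaces of the space of functions supported on `p` is brought to the normal form,
by maps `g` that identify its members with spaces of functions with smaller and smaller support. -/
theorem exists_levels_of_chain : ∀ (n : ℕ) (V : Fin (n + 1) → Type)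
    [∀ j, AddCommGroup (V j)] [∀ j, Module κ (V j)]
    (f : ∀ j : Fin n, V j.succ →ₗ[κ] V j.castSucc) (_ : ∀ j, Function.Injective (f j))
    (p : Fin r → Prop) (g₀ : V 0 →ₗ[κ] (Fin r → κ)) (_ : Function.Injective g₀)
    (_ : ∀ h, h ∈ LinearMap.range g₀ ↔ ∀ x, ¬ p x → h x = 0),
    ∃ (a : Fin r → ℕ) (u : Fin r → Fin r → κ) (g : ∀ j, V j →ₗ[κ] (Fin r → κ)), g 0 = g₀ ∧
      (∀ x, 0 < a x ↔ p x) ∧ (∀ x, a x ≤ n + 1) ∧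
      (∀ y x, u y x ≠ 0 → y < x ∧ 0 < a y ∧ a y < a x) ∧ (∀ j, Function.Injective (g j)) ∧
      (∀ j h, h ∈ LinearMap.range (g j) ↔ ∀ x, ¬ (j : ℕ) < a x → h x = 0) ∧
      ∀ (j : Fin n) v y, g j.castSucc (f j v) y =
        g j.succ v y + if a y = j + 1 then ∑ x, u y x * g j.succ v x else 0 := by
  classical
  intro n
  induction n with
  | zero =>
    intro V _ _ f hf p g₀ hg₀ hr
    refine ⟨fun x => if p x then 1 else 0, 0, Fin.cases g₀ (fun j => j.elim0), rfl, fun x => ?_,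
      fun x => ?_, fun y x h => absurd rfl h, Fin.cases hg₀ (fun j => j.elim0),
      Fin.cases (fun h => ?_) (fun j => j.elim0), fun j => j.elim0⟩
    · by_cases h : p x <;> simp [h]
    · by_cases h : p x <;> simp [h]
    · refine (hr h).trans (forall_congr' fun x => ?_)
      by_cases hx : p x <;> simp [hx]
  | succ n ih =>
    intro V _ _ f hf p g₀ hg₀ hr
    let ι : V (Fin.succ 0) →ₗ[κ] (Fin r → κ) := g₀ ∘ₗ f 0
    have hι : Function.Injective ι := hg₀.comp (hf 0)
    have hfin : FiniteDimensional κ (V (Fin.succ 0)) := FiniteDimensional.of_injective ι hι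
    -- The coordinate functions, restricted to the next space of the chain, span its dual because
    -- `ι` is injective. Elimination among them selects the coordinates that survive.
    let ρ : Fin r → Module.Dual κ (V (Fin.succ 0)) := fun y => LinearMap.proj y ∘ₗ ι
    have hρ : Submodule.span κ (Set.range ρ) = ⊤ := by
      rw [← Subspace.dualCoannihilator_dualAnnihilator_eq (W := Submodule.span κ (Set.range ρ))]
      have : (Submodule.span κ (Set.range ρ)).dualCoannihilator = ⊥ := by
        rw [eq_bot_iff]
        intro v hv
        rw [Submodule.mem_dualCoannihilator] at hv
        refine hι (funext fun y => ?_)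
        rw [map_zero]
        exact hv (ρ y) (Submodule.subset_span ⟨y, rfl⟩)
      rw [this, Submodule.dualAnnihilator_bot]
    obtain ⟨p', b, c, hb, hc, hρc⟩ := exists_basis_of_span_eq_top ρ hρ
    have hι0 : ∀ v y, ¬ p y → ι v y = 0 := fun v y hy => (hr (ι v)).mp ⟨f 0 v, rfl⟩ y hy
    have hpp : ∀ x, p' x → p x := by
      intro x hx
      by_contra h
      apply b.ne_zero ⟨x, hx⟩
      rw [hb]
      exact LinearMap.ext fun v => hι0 v x h
    -- Only the pivot coordinates are kept; the discarded ones are recovered from them through `c`.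
    let g₁ : V (Fin.succ 0) →ₗ[κ] (Fin r → κ) :=
      LinearMap.pi fun x => if p' x then ρ x else 0
    have hg₁ : ∀ v x, g₁ v x = if p' x then ι v x else 0 := fun v x => by
      simp only [g₁, LinearMap.pi_apply]
      split_ifs <;> rfl
    have hιg : ∀ v y, ¬ p' y → ι v y = ∑ x, c y x * g₁ v x := by
      intro v y hy
      have := LinearMap.congr_fun (hρc y hy) v
      rw [LinearMap.sum_apply] at this
      refine this.trans (Finset.sum_congr rfl fun x _ => ?_)
      by_cases h : c y x = 0
      · rw [h, zero_smul, zero_mul]; rfl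
      · rw [hg₁, if_pos (hc y x h).2.1]; rfl
    have hg₁i : Function.Injective g₁ := by
      rw [← LinearMap.ker_eq_bot, LinearMap.ker_eq_bot']
      intro v hv
      apply hι
      rw [map_zero]
      funext y
      by_cases hy : p' y
      · have := congrFun hv y
        rwa [hg₁, if_pos hy] at this
      · rw [hιg v y hy, hv]
        simp
    have hg₁r : ∀ h, h ∈ LinearMap.range g₁ ↔ ∀ x, ¬ p' x → h x = 0 := by
      intro h
      constructor
      · rintro ⟨v, rfl⟩ x hx
        rw [hg₁, if_neg hx]
      · intro h0
        -- An injective map between spaces of equal dimension, as the dual has a basis indexed by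
        -- `p'`; so it is onto.
        let q : V (Fin.succ 0) →ₗ[κ] ({x // p' x} → κ) := LinearMap.pi fun x => ρ x
        have hq : Function.Injective q := by
          intro v v' hvv
          apply hg₁i
          funext x
          rw [hg₁, hg₁]
          split_ifs with hx
          · exact congrFun hvv ⟨x, hx⟩
          · rfl
        have hdim : Module.finrank κ (V (Fin.succ 0)) = Module.finrank κ ({x // p' x} → κ) := by
          rw [Module.finrank_fintype_fun_eq_card, ← Module.finrank_eq_card_basis b, Subspace.dual_finrank_eq]
        obtain ⟨v, hv⟩ := (LinearMap.injective_iff_surjective_of_finrank_eq_finrank hdim).mp hq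
          (fun x => h x)
        refine ⟨v, funext fun x => ?_⟩
        rw [hg₁]
        split_ifs with hx
        · exact congrFun hv ⟨x, hx⟩
        · exact (h0 x hx).symm
    obtain ⟨a', u', g', hg0, ha0, ha, hu, hgi, hgr, hg⟩ := ih (fun j => V j.succ)
      (fun j => f j.succ) (fun j => hf j.succ) p' g₁ hg₁i hg₁r
    have hp0 : ∀ x, ¬ p x → a' x = 0 := fun x hx => by
      have := mt (ha0 x).mp (fun h => hx (hpp x h))
      omega
    -- One more space contains the coordinates in `p`, so their levels rise by one. Those with `a' y
    -- = 0` now have level `1`: they disappear at this step and take their parameters from `c`.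
    refine ⟨fun x => a' x + if p x then 1 else 0, fun y x => if p y then if a' y = 0 then c y x else u' y x else 0,
      Fin.cases g₀ g', rfl, fun x => ?_, fun x => ?_, fun y x hyx => ?_, Fin.cases hg₀ hgi,
      Fin.cases (fun h => ?_) (fun j h => ?_), Fin.cases (fun v y => ?_) (fun j v y => ?_)⟩
    · by_cases hx : p x
      · simp [hx]
      · simp [hx, hp0 x hx]
    · have := ha x
      dsimp only
      split_ifs <;> omega
    · have hy : p y := by
        by_contra hy
        exact hyx (if_neg hy)
      dsimp only at hyx ⊢
      rw [if_pos hy] at hyx ⊢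
      split_ifs at hyx with h0
      · obtain ⟨h1, h2, -⟩ := hc y x hyx
        have := (ha0 x).mpr h2
        rw [if_pos (hpp x h2)]
        exact ⟨h1, by omega, by omega⟩
      · obtain ⟨h1, h2, h3⟩ := hu y x hyx
        rw [if_pos (hpp x ((ha0 x).mp (by omega)))]
        exact ⟨h1, by omega, by omega⟩
    · refine (hr h).trans (forall_congr' fun x => ?_)
      by_cases hx : p x
      · simp [hx]
      · simp [hx, hp0 x hx]
    · refine (hgr j h).trans (forall_congr' fun x => ?_)
      by_cases hx : p x
      · simp [hx]
      · simp [hx, hp0 x hx]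
    · change ι v y = g' 0 v y + _
      rw [hg0, hg₁]
      by_cases hy : p y
      · by_cases hy' : p' y
        · have := (ha0 y).mpr hy'
          simp [hy, hy', this.ne']
        · have : a' y = 0 := by have := mt (ha0 y).mp hy'; omega
          rw [hιg v y hy', if_neg hy', zero_add, if_pos (by simp [this, hy])]
          refine Finset.sum_congr rfl fun x _ => ?_
          change _ = (if p y then if a' y = 0 then c y x else u' y x else 0) * g' 0 v x
          rw [if_pos hy, if_pos this, ← hg0]
      · rw [hι0 v y hy, if_neg (fun h => hy (hpp y h)), if_neg (by simp [hy, hp0 y hy]), add_zero]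
    · refine (hg j v y).trans (congrArg _ ?_)
      by_cases hy : p y
      · by_cases hj : a' y = j + 1
        · rw [if_pos hj, if_pos (by simp [hj, hy])]
          refine Finset.sum_congr rfl fun x _ => ?_
          change _ = (if p y then if a' y = 0 then c y x else u' y x else 0) * g' j.succ v x
          rw [if_pos hy, if_neg (by omega)]
        · rw [if_neg hj, if_neg (by simpa [hy] using hj)]
      · rw [if_neg (by rw [hp0 y hy]; omega), if_neg (by simp [hy, hp0 y hy])]

/-- Every representation given by flags has a normal form. -/
theorem Rep.Good.exists_normalForm {n : Vertex r s → Type} [∀ x, Fintype (n x)]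
    [∀ l, Unique (n (.short l))] {φ : Rep κ n} (hφ : φ.Good) :
    ∃ a u, Levelled s a u ∧ φ.Iso (normalForm s a u) := by
  classical
  have leg : ∀ i, ∃ (a : Fin r → ℕ) (u : Fin r → Fin r → κ)
      (g : ∀ j, (n (.long i j) → κ) →ₗ[κ] (Fin r → κ)), (∀ x, a x ≤ s i + 1) ∧
      (∀ y x, u y x ≠ 0 → y < x ∧ a y < a x) ∧ (∀ j, Function.Injective (g j)) ∧
      (∀ j h, h ∈ LinearMap.range (g j) ↔ ∀ x, ¬ (j : ℕ) < a x → h x = 0) ∧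
      (∀ l x, 0 < a x → g 0 (φ.col i l) x =
        (if x = l then 1 else 0) + if a l = 0 then u l x else 0) ∧
      ∀ (j : Fin (s i)) v y, g j.castSucc (φ.legMap i j v) y =
        g j.succ v y + if a y = j + 1 then ∑ x, u y x * g j.succ v x else 0 := by
    intro i
    obtain ⟨p, b, c, hb, hc, hbc⟩ := exists_basis_of_span_eq_top (φ.col i) (hφ.1 i)
    let g₀ : (n (.long i 0) → κ) →ₗ[κ] (Fin r → κ) :=
      LinearMap.pi fun x => if h : p x then b.coord ⟨x, h⟩ else 0
    have hg₀ : ∀ v x, g₀ v x = if h : p x then b.repr v ⟨x, h⟩ else 0 := fun v x => by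
      simp only [g₀, LinearMap.pi_apply]
      split_ifs <;> rfl
    have hcol : ∀ x, p x → g₀ (φ.col i x) = Pi.single x 1 := fun x hx => by
      funext z
      rw [hg₀, ← hb ⟨x, hx⟩, Module.Basis.repr_self, Pi.single_apply]
      by_cases hz : p z
      · rw [dif_pos hz, Finsupp.single_apply]
        exact if_congr (Subtype.ext_iff.trans eq_comm) rfl rfl
      · rw [dif_neg hz, if_neg (by rintro rfl; exact hz hx)]
    obtain ⟨a, u, g, hg0, ha0, ha, hu, hgi, hgr, hg⟩ := exists_levels_of_chain (s i)
      (fun j => n (.long i j) → κ) (φ.legMap i) (hφ.2 i) p g₀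
      (by
        rw [← LinearMap.ker_eq_bot, LinearMap.ker_eq_bot']
        intro v hv
        refine b.ext_elem fun x => ?_
        have := congrFun hv x.1
        rw [hg₀, dif_pos x.2] at this
        simpa using this)
      (fun h => by
        constructor
        · rintro ⟨v, rfl⟩ x hx
          rw [hg₀, dif_neg hx]
        · intro h0
          refine ⟨b.equivFun.symm (fun x => h x), funext fun x => ?_⟩
          rw [hg₀]
          split_ifs with hx
          · exact congrFun (b.equivFun.apply_symm_apply (fun x => h x)) ⟨x, hx⟩
          · exact (h0 x hx).symm)
    -- Elimination among the columns supplies the parameters at level `0`, elimination along the leg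
    -- those at positive levels.
    refine ⟨a, fun y x => if a y = 0 then c y x else u y x, g, ha, fun y x hyx => ?_, hgi, hgr,
      fun l x hx => ?_, fun j v y => ?_⟩
    · dsimp only at hyx
      split_ifs at hyx with hy
      · obtain ⟨h1, h2, -⟩ := hc y x hyx
        exact ⟨h1, hy ▸ (ha0 x).mpr h2⟩
      · exact ⟨(hu y x hyx).1, (hu y x hyx).2.2⟩
    · rw [hg0]
      by_cases hl : p l
      · have := (ha0 l).mpr hl
        rw [hcol l hl, Pi.single_apply, if_neg this.ne', add_zero]
      · have h0 : a l = 0 := by have := mt (ha0 l).mp hl; omega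
        dsimp only
        rw [hbc l hl, map_sum, if_pos h0, if_pos h0, if_neg (by rintro rfl; omega), zero_add,
          Finset.sum_apply, Finset.sum_eq_single x]
        · rw [map_smul, hcol x ((ha0 x).mp hx)]
          simp
        · intro z _ hz
          by_cases h : c l z = 0
          · simp [h]
          · rw [map_smul, hcol z (hc l z h).2.1]
            simp [hz.symm]
        · simp
    · rw [hg]
      congr 1
      split_ifs with hy
      · refine Finset.sum_congr rfl fun x _ => ?_
        dsimp only
        rw [if_neg (show a y ≠ 0 by omega)]
      · rfl
  choose a u g ha hu hgi hgr hcol hleg using leg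
  have hL : Levelled s a (fun e => u e.1 e.2.1 e.2.2) :=
    ⟨ha, fun h => (hu _ _ _ h).1, fun h => (hu _ _ _ h).2⟩
  refine ⟨a, fun e => u e.1 e.2.1 e.2.2, hL, ?_⟩
  let G : ∀ v : Vertex r s, (n v → κ) ≃ₗ[κ] (LevelIndex s a v → κ) := fun v =>
    match v with
    | .short l => LinearEquiv.funCongrLeft κ κ (Equiv.ofUnique (LevelIndex s a (.short l)) (n (.short l)))
    | .long i j => LinearEquiv.ofBijective
        (LinearMap.funLeft κ κ (fun x : LevelIndex s a (.long i j) => x.1) ∘ₗ g i j) (by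
          constructor
          · rw [← LinearMap.ker_eq_bot, LinearMap.ker_eq_bot']
            intro v hv
            apply hgi i j
            rw [map_zero]
            funext x
            by_cases hx : (j : ℕ) < a i x
            · exact congrFun hv ⟨x, hx⟩
            · exact (hgr i j _).mp ⟨v, rfl⟩ x hx
          · intro h
            obtain ⟨v, hv⟩ := (hgr i j (fun x => if hx : (j : ℕ) < a i x then h ⟨x, hx⟩ else 0)).mpr
              (fun x hx => dif_neg hx)
            refine ⟨v, funext fun x => ?_⟩
            exact (congrFun hv x.1).trans (dif_pos x.2))
  have hG : ∀ i j v x, G (.long i j) v x = g i j v x.1 := fun i j v x => rfl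
  refine ⟨G, (Rep.isHom_iff (g := fun v => (G v).toLinearMap) (t := 1) (fun l => ?_)).mpr ⟨fun i l => ?_, fun i j v => ?_⟩⟩
  · rw [Pi.one_apply, one_smul]; rfl
  · funext x
    rw [Pi.one_apply, one_smul, normalForm_col]
    exact hcol i l x.1 x.2
  · funext y
    refine (hleg i j v y.1).trans ?_
    by_cases hy : (j : ℕ) + 1 < a i y.1
    · rw [if_neg (by omega), add_zero]
      exact (normalForm_legMap_of_lt i j (G (.long i j.succ) v) y ⟨y.1, hy⟩ rfl).symm
    · have hy1 : (j : ℕ) < a i y.1 := y.2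
      have hj : a i y.1 = j + 1 := by omega
      rw [if_pos hj, (hgr i j.succ _).mp ⟨v, rfl⟩ y.1 hy, zero_add]
      refine Eq.trans ?_ (normalForm_legMap_of_eq i j (G (.long i j.succ) v) y hj).symm
      refine sum_eq_sum_subtype (fun x => LevelMem a (.long i j.succ : Vertex r s) x) fun x hx => ?_
      rw [(hgr i j.succ _).mp ⟨v, rfl⟩ x hx, mul_zero]

end Existence

/-! ### Block permutations and words of levels -/

section Words

variable {r d : ℕ}

/-- The map that sends an element of `Fin r` to its block. -/
theorem exists_block_map (c : Fin (d + 1) → ℕ) (hc : ∑ f, c f = r) :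
    ∃ β : Fin r → Fin (d + 1), Antitone β ∧ (∀ p x, InBlock c p x ↔ β x = p) ∧
      ∀ p, (Finset.univ.filter fun x => p ≤ β x).card = ∑ f ∈ Finset.Ici p, c f := by
  classical
  have hmono : ∀ p p' : Fin (d + 1), p < p' → ∑ f ∈ Finset.Ici p', c f ≤ ∑ f ∈ Finset.Ioi p, c f :=
    fun p p' h => Finset.sum_le_sum_of_subset fun f hf => by
      rw [Finset.mem_Ici] at hf
      exact Finset.mem_Ioi.mpr (lt_of_lt_of_le h hf)
  have hmono' : ∀ p p' : Fin (d + 1), p ≤ p' → ∑ f ∈ Finset.Ici p', c f ≤ ∑ f ∈ Finset.Ici p, c f :=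
    fun p p' h => Finset.sum_le_sum_of_subset (Finset.Ici_subset_Ici.mpr h)
  have hex : ∀ x : Fin r, ∃ p, InBlock c p x := fun x => by
    have h0 : (Finset.univ.filter fun p : Fin (d + 1) => (x : ℕ) < ∑ f ∈ Finset.Ici p, c f).Nonempty := by
      refine ⟨0, Finset.mem_filter.mpr ⟨Finset.mem_univ _, ?_⟩⟩
      have : Finset.Ici (0 : Fin (d + 1)) = Finset.univ := by ext; simp
      rw [this, hc]
      exact x.2
    let p := Finset.max' _ h0
    -- The block of `x` is the last index whose tail sum still exceeds `x`; by maximality the next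
    -- tail sum does not.
    refine ⟨p, ?_, (Finset.mem_filter.mp (Finset.max'_mem _ h0)).2⟩
    obtain ⟨q, hq⟩ | hq := Fin.eq_castSucc_or_eq_last p
    · have : Finset.Ioi p = Finset.Ici q.succ := by
        ext f
        rw [hq, Finset.mem_Ioi, Finset.mem_Ici, Fin.castSucc_lt_iff_succ_le]
      rw [this]
      by_contra! hlt
      have : q.succ ≤ p := Finset.le_max' _ q.succ (by simpa using hlt)
      rw [hq] at this
      exact absurd this (not_le.mpr Fin.castSucc_lt_succ)
    · have : Finset.Ioi p = ∅ := by
        ext f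
        simp [hq, Fin.le_last]
      simp [this]
  choose β hβ using hex
  have hanti : ∀ x y : Fin r, β x < β y → y < x := fun x y h =>
    Fin.lt_def.mpr (lt_of_lt_of_le (hβ y).2 ((hmono _ _ h).trans (hβ x).1))
  refine ⟨β, fun x y hxy => not_lt.mp fun h => not_lt.mpr hxy (hanti x y h), fun p x => ?_, fun p => ?_⟩
  · refine ⟨fun h => ?_, fun h => h ▸ hβ x⟩
    obtain hlt | heq | hlt := lt_trichotomy (β x) p
    · exact absurd (h.2.trans_le ((hmono _ _ hlt).trans (hβ x).1)) (lt_irrefl _)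
    · exact heq
    · exact absurd ((hβ x).2.trans_le ((hmono _ _ hlt).trans h.1)) (lt_irrefl _)
  · have : ∀ x, p ≤ β x ↔ (x : ℕ) < ∑ f ∈ Finset.Ici p, c f := fun x => by
      refine ⟨fun h => (hβ x).2.trans_le (hmono' _ _ h), fun h => ?_⟩
      by_contra! hlt
      exact absurd (h.trans_le ((hmono _ _ hlt).trans (hβ x).1)) (lt_irrefl _)
    simp only [this]
    have hle : ∑ f ∈ Finset.Ici p, c f ≤ r :=
      hc ▸ Finset.sum_le_sum_of_subset (Finset.subset_univ _)
    rw [Fin.card_filter_val_lt, min_eq_right hle]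

theorem card_fiber_eq_of_card_le_eq {a b : Fin r → Fin (d + 1)}
    (h : ∀ p, (Finset.univ.filter fun x => p ≤ a x).card = (Finset.univ.filter fun x => p ≤ b x).card)
    (p : Fin (d + 1)) :
    (Finset.univ.filter fun x => a x = p).card = (Finset.univ.filter fun x => b x = p).card := by
  obtain ⟨q, rfl⟩ | rfl := Fin.eq_castSucc_or_eq_last p
  · have key : ∀ a : Fin r → Fin (d + 1), (Finset.univ.filter fun x => q.castSucc ≤ a x).card =
        (Finset.univ.filter fun x => a x = q.castSucc).card +
          (Finset.univ.filter fun x => q.succ ≤ a x).card := fun a => by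
      rw [← Finset.card_union_of_disjoint]
      · congr 1
        ext x
        simp only [Finset.mem_filter, Finset.mem_univ, true_and, Finset.mem_union]
        rw [← Fin.castSucc_lt_iff_succ_le, le_iff_eq_or_lt, eq_comm]
      · rw [Finset.disjoint_filter]
        rintro x - h1 h2
        rw [h1] at h2
        exact absurd h2 (not_le.mpr Fin.castSucc_lt_succ)
    have h1 := h q.castSucc
    rw [key, key, h q.succ] at h1
    omega
  · simpa [Fin.last_le_iff] using h (Fin.last d)

variable {c : Fin (d + 1) → ℕ} {β : Fin r → Fin (d + 1)}

theorem mem_blockPerms {w : Equiv.Perm (Fin r)} : w ∈ blockPerms r c ↔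
    ∀ p x y, InBlock c p x → InBlock c p y → x < y → w⁻¹ x < w⁻¹ y := by
  classical
  simp [blockPerms]

/-- The inverses of block permutations are stable sorts: sortedness is the antitonicity of `β`, and
the rule for ties is the condition on blocks. Hence `w` is determined by the word `β ∘ w`. -/
theorem mem_blockPerms_iff (hβ : Antitone β) (hβc : ∀ p x, InBlock c p x ↔ β x = p)
    (w : Equiv.Perm (Fin r)) :
    w ∈ blockPerms r c ↔ w⁻¹ = Tuple.sort (OrderDual.toDual ∘ β ∘ w) := by
  rw [Tuple.eq_sort_iff, mem_blockPerms]
  have h1 : ∀ x, (OrderDual.toDual ∘ β ∘ w) (w⁻¹ x) = OrderDual.toDual (β x) := fun x => by simp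
  constructor
  · intro h
    refine ⟨fun x y hxy => ?_, fun x y hxy he => ?_⟩
    · exact (h1 x).le.trans ((OrderDual.toDual_le_toDual.mpr (hβ hxy)).trans (h1 y).ge)
    · rw [h1, h1] at he
      exact h (β x) x y ((hβc _ _).mpr rfl) ((hβc _ _).mpr (OrderDual.toDual.injective he).symm) hxy
  · rintro ⟨-, h⟩
    refine fun p x y hx hy hxy => h x y hxy ?_
    rw [h1, h1, (hβc _ _).mp hx, (hβc _ _).mp hy]

/-- Two values in the same block are never inverted, and across blocks the order is opposite to that
of the labels. -/
theorem inversion_iff (hβ : Antitone β) (hβc : ∀ p x, InBlock c p x ↔ β x = p)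
    {w : Equiv.Perm (Fin r)} (hw : w ∈ blockPerms r c) {y x : Fin r} (hyx : y < x) :
    w x < w y ↔ β (w y) < β (w x) := by
  refine ⟨fun h => lt_of_le_of_ne (hβ h.le) fun he => ?_, fun h => ?_⟩
  · have := mem_blockPerms.mp hw (β (w y)) (w x) (w y) ((hβc _ _).mpr he.symm)
      ((hβc _ _).mpr rfl) h
    simp only [Equiv.Perm.coe_inv, Equiv.symm_apply_apply] at this
    exact lt_asymm this hyx
  · by_contra! hle
    exact not_le.mpr h (hβ hle)

theorem eq_of_mem_blockPerms (hβ : Antitone β) (hβc : ∀ p x, InBlock c p x ↔ β x = p)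
    {w w' : Equiv.Perm (Fin r)} (hw : w ∈ blockPerms r c) (hw' : w' ∈ blockPerms r c)
    (h : ∀ x, β (w x) = β (w' x)) : w = w' := by
  rw [mem_blockPerms_iff hβ hβc] at hw hw'
  have : β ∘ w = β ∘ w' := funext h
  rw [this, ← hw'] at hw
  exact inv_injective hw

theorem exists_mem_blockPerms (hβ : Antitone β) (hβc : ∀ p x, InBlock c p x ↔ β x = p)
    (hcard : ∀ p, (Finset.univ.filter fun x => p ≤ β x).card = ∑ f ∈ Finset.Ici p, c f)
    (a : Fin r → Fin (d + 1))
    (ha : ∀ p, (Finset.univ.filter fun x => p ≤ a x).card = ∑ f ∈ Finset.Ici p, c f) :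
    ∃ w ∈ blockPerms r c, ∀ x, β (w x) = a x := by
  have hfib := card_fiber_eq_of_card_le_eq (a := β) (b := a) fun p => (hcard p).trans (ha p).symm
  -- The words `a` and `β` have the same content, so `β`, which is already sorted in decreasing
  -- order, is the sorted form of `a`. The required `w` is the inverse of the sorting permutation.
  let τ : Equiv.Perm (Fin r) := Equiv.ofFiberEquiv (f := β) (g := a) fun p =>
    Fintype.equivOfCardEq (by rw [Fintype.card_subtype, Fintype.card_subtype]; exact hfib p)
  have hτ : ∀ x, a (τ x) = β x := fun x => Equiv.ofFiberEquiv_map _ x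
  let f : Fin r → (Fin (d + 1))ᵒᵈ := OrderDual.toDual ∘ a
  have hm : Monotone (f ∘ τ) := fun x y hxy => by
    simp only [f, Function.comp_apply, hτ]
    exact hβ hxy
  have heq := Tuple.unique_monotone hm (Tuple.monotone_sort f)
  have hs : ∀ x, β x = a (Tuple.sort f x) := fun x => by
    rw [← hτ]
    exact OrderDual.toDual.injective (congrFun heq x)
  have hβs : ∀ x, β ((Tuple.sort f)⁻¹ x) = a x := fun x => by
    rw [hs]; simp
  refine ⟨(Tuple.sort f)⁻¹, (mem_blockPerms_iff hβ hβc _).mpr ?_, hβs⟩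
  rw [inv_inv, show β ∘ ⇑(Tuple.sort f)⁻¹ = a from funext hβs]

end Words

/-! ### The bound `|μ^i| ≤ r` from the fundamental set -/

section Fundamental

variable {r k : ℕ} {s : Fin k → ℕ}

theorem Arrow.heq_of_eq {x y x' y' : Vertex r s} (a : Arrow r s x y) (b : Arrow r s x' y')
    (hx : x = x') (hy : y = y') : HEq a b := by
  obtain ⟨l, i⟩ | ⟨i, j⟩ := a <;> obtain ⟨l', i'⟩ | ⟨i', j'⟩ := b
  · obtain rfl := Vertex.short.inj hx
    obtain ⟨rfl, -⟩ := Vertex.long.inj hy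
    rfl
  · cases hx
  · cases hx
  · obtain ⟨rfl, h⟩ := Vertex.long.inj hx
    obtain rfl := Fin.succ_injective _ (eq_of_heq h)
    rfl

instance (x y : Vertex r s) : Subsingleton (x ⟶ y) :=
  ⟨fun a b => eq_of_heq (Arrow.heq_of_eq a b rfl rfl)⟩

theorem Arrow.eq_succ {x y : Vertex r s} (a : Arrow r s x y) {i i' : Fin k} {j : Fin (s i + 1)}
    {j' : Fin (s i' + 1)} (hx : x = .long i j) (hy : y = .long i' j') : i = i' ∧ (j : ℕ) = j' + 1 := by
  obtain ⟨l, i⟩ | ⟨i, m⟩ := a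
  · cases hx
  · obtain ⟨rfl, h⟩ := Vertex.long.inj hx
    obtain ⟨rfl, h'⟩ := Vertex.long.inj hy
    rw [← eq_of_heq h, ← eq_of_heq h']
    exact ⟨rfl, rfl⟩

/-- Lower bounds for the Cartan entries suffice, as they get multiplied by non-negative dimensions.
-/
theorem cartan_short (i : Fin k) (l : Fin r) :
    -1 ≤ cartan (Vertex r s) (.long i 0) (.short l) := by
  have h1 : IsEmpty ((.long i 0 : Vertex r s) ⟶ .short l) := ⟨fun a => nomatch a⟩
  have h2 : Nat.card ((.short l : Vertex r s) ⟶ .long i 0) ≤ 1 := Finite.card_le_one_iff_subsingleton.mpr inferInstance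
  rw [cartan, if_neg (by simp), Nat.card_of_isEmpty]
  omega

theorem cartan_long (i i' : Fin k) (j : Fin (s i' + 1)) :
    (if i' = i ∧ (j : ℕ) = 0 then 2 else if i' = i ∧ (j : ℕ) = 1 then -1 else 0) ≤
      cartan (Vertex r s) (.long i 0) (.long i' j) := by
  rw [cartan]
  have h1 : IsEmpty ((.long i 0 : Vertex r s) ⟶ .long i' j) := ⟨fun a => by
    have := (Arrow.eq_succ a rfl rfl).2
    simp at this⟩
  have h2 : Nat.card ((.long i' j : Vertex r s) ⟶ .long i 0) ≤ 1 :=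
    Finite.card_le_one_iff_subsingleton.mpr inferInstance
  have h3 : ¬ (i' = i ∧ (j : ℕ) = 1) → Nat.card ((.long i' j : Vertex r s) ⟶ .long i 0) = 0 := fun h => by
    have : IsEmpty ((.long i' j : Vertex r s) ⟶ .long i 0) := ⟨fun a => h (by
      have := Arrow.eq_succ a rfl rfl
      simpa using this)⟩
    exact Nat.card_of_isEmpty
  rw [Nat.card_of_isEmpty]
  by_cases h0 : i' = i ∧ (j : ℕ) = 0
  · obtain ⟨rfl, hj⟩ := h0
    obtain rfl : j = 0 := Fin.ext hj
    simp
  · have hne : (.long i 0 : Vertex r s) ≠ .long i' j := fun h => by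
      obtain ⟨rfl, hj⟩ := Vertex.long.inj h
      exact h0 ⟨rfl, by rw [← eq_of_heq hj]; rfl⟩
    rw [if_neg h0, if_neg hne]
    split_ifs with h
    · omega
    · rw [h3 h]; simp

/-- The vertices as a disjoint union. -/
def vertexEquiv (r : ℕ) (s : Fin k → ℕ) : Vertex r s ≃ Fin r ⊕ Σ i, Fin (s i + 1) where
  toFun
    | .short l => .inl l
    | .long i j => .inr ⟨i, j⟩
  invFun
    | .inl l => .short l
    | .inr ⟨i, j⟩ => .long i j
  left_inv x := by cases x <;> rfl
  right_inv x := by rcases x with l | ⟨i, j⟩ <;> rfl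

/-- Pair the dimension vector with the basis vector at `(i;0)`: the vertex itself contributes
`2|μ^i|`, the vertex `(i;1)` at least `-|μ^i|`, the short vertices at least `-r`, and the rest is
non-negative. -/
theorem sum_le_of_mem_fundamentalSet (μ : ∀ i, Fin (s i + 1) → ℕ)
    (h : dimVector r μ ∈ fundamentalSet (Vertex r s)) (i : Fin k) : ∑ f, μ i f ≤ r := by
  have h1 := h.2.2 (.long i 0)
  have h2 : cartanForm (Vertex r s) (Pi.single (.long i 0) 1) (fun x => (dimVector r μ x : ℤ)) =
      ∑ x, cartan (Vertex r s) (.long i 0) x * dimVector r μ x := by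
    rw [cartanForm, Finset.sum_eq_single (.long i 0)]
    · simp
    · intro x _ hx
      simp [Pi.single_eq_of_ne hx]
    · simp
  rw [h2, ← (vertexEquiv r s).symm.sum_comp, Fintype.sum_sum_type, Fintype.sum_sigma] at h1
  change ∑ l : Fin r, cartan (Vertex r s) (.long i 0) (.short l) * ((1 : ℕ) : ℤ) +
    ∑ i', ∑ j, cartan (Vertex r s) (.long i 0) (.long i' j) *
      ((∑ f ∈ Finset.Ici j, μ i' f : ℕ) : ℤ) ≤ 0 at h1
  set N : ℤ := ((∑ f, μ i f : ℕ) : ℤ)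
  have h3 : -(r : ℤ) ≤ ∑ l : Fin r, cartan (Vertex r s) (.long i 0) (.short l) * ((1 : ℕ) : ℤ) := by
    have := Finset.card_nsmul_le_sum (Finset.univ : Finset (Fin r))
      (fun l => cartan (Vertex r s) (.long i 0) (.short l) * ((1 : ℕ) : ℤ)) (-1)
      (fun l _ => by simpa using cartan_short i l)
    simpa using this
  have h4 : ∀ i', i' ≠ i → 0 ≤ ∑ j, cartan (Vertex r s) (.long i 0) (.long i' j) *
      ((∑ f ∈ Finset.Ici j, μ i' f : ℕ) : ℤ) := fun i' hi =>
    Finset.sum_nonneg fun j _ => mul_nonneg (by simpa [hi] using cartan_long (r := r) i i' j) (by positivity)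
  have h5 : N ≤ ∑ j, cartan (Vertex r s) (.long i 0) (.long i j) *
      ((∑ f ∈ Finset.Ici j, μ i f : ℕ) : ℤ) := by
    have h0 : Finset.Ici (0 : Fin (s i + 1)) = Finset.univ := by ext; simp
    have hle : ∀ j : Fin (s i), ((if (j : ℕ) = 0 then -N else 0) : ℤ) ≤
        cartan (Vertex r s) (.long i 0) (.long i j.succ) *
          ((∑ f ∈ Finset.Ici j.succ, μ i f : ℕ) : ℤ) := fun j => by
      have hc := cartan_long (r := r) i i j.succ
      have hN : ((∑ f ∈ Finset.Ici j.succ, μ i f : ℕ) : ℤ) ≤ N :=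
        Nat.cast_le.mpr (Finset.sum_le_sum_of_subset (Finset.subset_univ _))
      have hp : 0 ≤ ((∑ f ∈ Finset.Ici j.succ, μ i f : ℕ) : ℤ) := by positivity
      by_cases hj : (j : ℕ) = 0
      · simp only [Fin.val_succ, hj] at hc
        norm_num at hc
        rw [if_pos hj]
        nlinarith
      · rw [if_neg hj]
        refine mul_nonneg ?_ hp
        simpa [hj] using hc
    have hsum := Finset.sum_le_sum fun j (_ : j ∈ Finset.univ) => hle j
    have hsum' : -N ≤ ∑ j : Fin (s i), ((if (j : ℕ) = 0 then -N else 0) : ℤ) := by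
      have hN0 : 0 ≤ N := by positivity
      by_cases hs : ∃ j₀ : Fin (s i), (j₀ : ℕ) = 0
      · obtain ⟨j₀, hj₀⟩ := hs
        rw [Finset.sum_eq_single j₀]
        · rw [if_pos hj₀]
        · intro j _ hj
          exact if_neg fun h => hj (Fin.ext (h.trans hj₀.symm))
        · simp
      · rw [Finset.sum_eq_zero fun j _ => if_neg fun h => hs ⟨j, h⟩]
        omega
    rw [Fin.sum_univ_succ, h0]
    have hself : cartan (Vertex r s) (.long i 0) (.long i 0) = 2 := by simp [cartan]
    rw [hself]
    linarith
  rw [← Finset.add_sum_erase _ _ (Finset.mem_univ i)] at h1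
  have h6 := Finset.sum_nonneg fun i' (hi' : i' ∈ Finset.univ.erase i) => h4 i' (Finset.ne_of_mem_erase hi')
  have : N ≤ r := by linarith
  exact Nat.cast_le.mp this

end Fundamental
-- Counting normal forms and torus orbits
section Count

variable {r k : ℕ} {s : Fin k → ℕ} {κ : Type} [Field κ]

theorem sum_tilde {d : ℕ} (μ : Fin d → ℕ) (h : ∑ f, μ f ≤ r) : ∑ f, tilde r μ f = r := by
  rw [Fin.sum_univ_succ]
  simp only [tilde, Fin.cons_zero, Fin.cons_succ]
  omega

theorem sum_Ici_tilde {d : ℕ} (μ : Fin d → ℕ) (j : Fin d) :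
    ∑ f ∈ Finset.Ici j.succ, tilde r μ f = ∑ f ∈ Finset.Ici j, μ f := by
  rw [← Fin.map_succEmb_Ici, Finset.sum_map]
  rfl

/-- The map `β` sends an element to its block. -/
structure IsBlockMap {d : ℕ} (c : Fin (d + 1) → ℕ) (β : Fin r → Fin (d + 1)) : Prop where
  antitone : Antitone β
  inBlock_iff : ∀ p x, InBlock c p x ↔ β x = p
  card : ∀ p, (Finset.univ.filter fun x => p ≤ β x).card = ∑ f ∈ Finset.Ici p, c f

/-- The levels attached to a tuple of permutations. -/
def levels (β : ∀ i, Fin r → Fin (s i + 1 + 1)) (w : Fin k → Equiv.Perm (Fin r)) :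
    Fin k → Fin r → ℕ := fun i x => β i (w i x)

variable {μ : ∀ i, Fin (s i + 1) → ℕ} {β : ∀ i, Fin r → Fin (s i + 1 + 1)}

theorem levelled_iff (hβ : ∀ i, IsBlockMap (tilde r (μ i)) (β i))
    {w : Fin k → Equiv.Perm (Fin r)} (hw : w ∈ permTuples r μ) (u : Fin k × Fin r × Fin r → κ) :
    Levelled s (levels β w) u ↔ edgeSupport u ⊆ inversionEdges w := by
  have hinv : ∀ i {y x : Fin r}, y < x → (w i x < w i y ↔ β i (w i y) < β i (w i x)) :=
    fun i y x => inversion_iff (hβ i).antitone (hβ i).inBlock_iff (Fintype.mem_piFinset.mp hw i)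
  constructor
  · rintro h ⟨i, y, x⟩ he
    have hu : u (i, y, x) ≠ 0 := by simpa [edgeSupport] using he
    simp only [inversionEdges, Finset.mem_filter, Finset.mem_univ, true_and]
    exact ⟨h.lt hu, (hinv i (h.lt hu)).mpr (h.level_lt hu)⟩
  · intro h
    have h' : ∀ {i y x}, u (i, y, x) ≠ 0 → y < x ∧ w i x < w i y := fun {i y x} hu => by
      have := h (show (i, y, x) ∈ edgeSupport u by simpa [edgeSupport] using hu)
      simpa [inversionEdges] using this
    exact ⟨fun i x => Nat.le_of_lt_succ (β i (w i x)).2, fun hu => (h' hu).1,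
      fun {i y x} hu => (hinv i (h' hu).1).mp (h' hu).2⟩

/-- The parameters of the normal forms of the absolutely indecomposable representations. -/
abbrev NormalFormParam (κ : Type) [Field κ] (μ : ∀ i, Fin (s i + 1) → ℕ) (r : ℕ) : Type :=
  {y : (Fin k → Equiv.Perm (Fin r)) × (Fin k × Fin r × Fin r → κ) //
    y.1 ∈ permTuples r μ ∧ edgeSupport y.2 ⊆ inversionEdges y.1 ∧
      IsConnectedSpanning (edgeSupport y.2)}

theorem exists_param (hr : 0 < r) (hμ : ∀ i, ∑ f, μ i f ≤ r)
    (hβ : ∀ i, IsBlockMap (tilde r (μ i)) (β i))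
    {φ : Rep κ (fun x => Fin (dimVector r μ x))} (hφ : φ.AbsolutelyIndecomposable) :
    ∃ y : NormalFormParam κ μ r, φ.Iso (normalForm s (levels β y.1.1) y.1.2) := by
  let _ : ∀ l, Unique (Fin (dimVector r μ (.short l))) := fun l => inferInstanceAs (Unique (Fin 1))
  obtain ⟨a, u, hL, hiso⟩ :=
    (Rep.good_of_trivialIdempotents hr ((Rep.indecomposable_iff φ).mp hφ.1).2).exists_normalForm
  have hcard : ∀ i (j : Fin (s i + 1)), (Finset.univ.filter fun x => (j : ℕ) < a i x).card =
      ∑ f ∈ Finset.Ici j, μ i f := by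
    intro i j
    obtain ⟨g, -⟩ := hiso
    have := (g (.long i j)).finrank_eq
    rw [Module.finrank_fintype_fun_eq_card, Module.finrank_fintype_fun_eq_card, Fintype.card_fin,
      Fintype.card_subtype] at this
    exact this.symm
  have hex : ∀ i, ∃ w ∈ blockPerms r (tilde r (μ i)), ∀ x, β i (w x) =
      (⟨a i x, Nat.lt_succ_of_le (hL.le i x)⟩ : Fin (s i + 1 + 1)) := by
    intro i
    refine exists_mem_blockPerms (hβ i).antitone (hβ i).inBlock_iff (hβ i).card _ ?_
    refine Fin.cases ?_ fun j => ?_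
    -- Level `0` takes up the remaining `r - |μ^i|` elements; the subtraction is exact because
    -- `|μ^i| ≤ r`.
    · have h0 : Finset.Ici (0 : Fin (s i + 1 + 1)) = Finset.univ := by ext; simp
      rw [h0, sum_tilde _ (hμ i)]
      simp
    · rw [sum_Ici_tilde, ← hcard]
      rfl
  choose w hw hwa using hex
  have hlev : levels β w = a := funext fun i => funext fun x => congrArg Fin.val (hwa i x)
  subst hlev
  have hw' : w ∈ permTuples r μ := Fintype.mem_piFinset.mpr hw
  have hv : dimVector r μ ≠ 0 := fun h => one_ne_zero (congrFun h (.short ⟨0, hr⟩))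
  refine ⟨⟨(w, u), hw', (levelled_iff hβ hw' u).mp hL,
    (absolutelyIndecomposable_iff hr hL hv hiso).mp hφ⟩, hiso⟩

theorem exists_rep (hr : 0 < r) (hβ : ∀ i, IsBlockMap (tilde r (μ i)) (β i))
    (y : NormalFormParam κ μ r) :
    ∃ φ : Rep κ (fun x => Fin (dimVector r μ x)), φ.AbsolutelyIndecomposable ∧
      φ.Iso (normalForm s (levels β y.1.1) y.1.2) := by
  obtain ⟨⟨w, u⟩, hw, hsub, hconn⟩ := y
  obtain ⟨φ, hφ⟩ := Rep.exists_iso_fin (normalForm s (levels β w) u) (dimVector r μ) (by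
    rintro (l | ⟨i, j⟩)
    · rw [Fintype.card_unique]; rfl
    · rw [Fintype.card_subtype]
      refine Eq.trans ?_ (sum_Ici_tilde (r := r) (μ i) j)
      rw [← (hβ i).card]
      refine Finset.card_bij' (fun x _ => w i x) (fun x _ => (w i).symm x) ?_ ?_ ?_ ?_
      · intro x hx
        exact Finset.mem_filter.mpr ⟨Finset.mem_univ _, (Finset.mem_filter.mp hx).2⟩
      · intro x hx
        refine Finset.mem_filter.mpr ⟨Finset.mem_univ _, ?_⟩
        have h := (Finset.mem_filter.mp hx).2
        change (j : ℕ) < β i (w i ((w i).symm x))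
        rw [Equiv.apply_symm_apply]
        exact h
      · simp
      · simp)
  have hv : dimVector r μ ≠ 0 := fun h => one_ne_zero (congrFun h (.short ⟨0, hr⟩))
  exact ⟨φ, (absolutelyIndecomposable_iff hr ((levelled_iff hβ hw u).mpr hsub) hv hφ).mpr hconn, hφ⟩

theorem eq_of_levels_eq (hβ : ∀ i, IsBlockMap (tilde r (μ i)) (β i))
    {w w' : Fin k → Equiv.Perm (Fin r)} (hw : w ∈ permTuples r μ) (hw' : w' ∈ permTuples r μ)
    (h : levels β w = levels β w') : w = w' :=
  funext fun i => eq_of_mem_blockPerms (hβ i).antitone (hβ i).inBlock_iff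
    (Fintype.mem_piFinset.mp hw i) (Fintype.mem_piFinset.mp hw' i)
    fun x => Fin.val_injective (congrFun (congrFun h i) x)

/-- The action of diagonal matrices on the parameters of normal forms. -/
def scale (a : Fin k → Fin r → ℕ) (t : Fin r → κ) (u : Fin k × Fin r × Fin r → κ) :
    Fin k × Fin r × Fin r → κ := fun e =>
  (if a e.1 e.2.1 = 0 then t e.2.2 * (t e.2.1)⁻¹ else t e.2.1 * (t e.2.2)⁻¹) * u e

theorem scaledBy_iff {a : Fin k → Fin r → ℕ} {t : Fin r → κ} (ht : ∀ x, t x ≠ 0)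
    {u u' : Fin k × Fin r × Fin r → κ} : ScaledBy a t u u' ↔ u' = scale a t u := by
  constructor
  · intro h
    funext ⟨i, y, x⟩
    have h1 := ht x
    have h2 := ht y
    have := h i y x
    simp only [scale]
    split_ifs at this ⊢
    · field_simp
      rw [this, mul_comm]
    · field_simp
      rw [this, mul_comm]
  · rintro rfl i y x
    have h1 := ht x
    have h2 := ht y
    simp only [scale]
    split_ifs
    · field_simp
    · field_simp

theorem edgeSupport_scale {a : Fin k → Fin r → ℕ} {t : Fin r → κ} (ht : ∀ x, t x ≠ 0)
    (u : Fin k × Fin r × Fin r → κ) : edgeSupport (scale a t u) = edgeSupport u := by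
  ext e
  simp only [mem_edgeSupport, scale, ne_eq, mul_eq_zero, not_or, and_iff_right_iff_imp]
  intro _
  split_ifs <;> simp [ht]

/-- Non-zero functions with value `1` at a given point. -/
def extendOne (x₀ : Fin r) (t : {x : Fin r // x ≠ x₀} → κˣ) (x : Fin r) : κ :=
  if h : x = x₀ then 1 else t ⟨x, h⟩

theorem extendOne_ne_zero (x₀ : Fin r) (t : {x : Fin r // x ≠ x₀} → κˣ) (x : Fin r) :
    extendOne x₀ t x ≠ 0 := by
  unfold extendOne
  split_ifs <;> simp

theorem extendOne_self (x₀ : Fin r) (t : {x : Fin r // x ≠ x₀} → κˣ) : extendOne x₀ t x₀ = 1 :=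
  dif_pos rfl

theorem extendOne_of_ne (x₀ : Fin r) (t : {x : Fin r // x ≠ x₀} → κˣ) {x : Fin r} (hx : x ≠ x₀) :
    extendOne x₀ t x = t ⟨x, hx⟩ := dif_neg hx

/-- The parameters of one isomorphism class form a torus orbit. Constants act trivially, and the
subtorus with entry `1` at `x₀` acts freely because the support is connected. -/
theorem card_normalFormParam [Fintype κ] (hr : 0 < r) (hμ : ∀ i, ∑ f, μ i f ≤ r)
    (hβ : ∀ i, IsBlockMap (tilde r (μ i)) (β i)) :
    Nat.card (NormalFormParam κ μ r) =
      numAbsIndec (Vertex r s) κ (dimVector r μ) * (Fintype.card κ - 1) ^ (r - 1) := by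
  classical
  let x₀ : Fin r := ⟨0, hr⟩
  let A := {c : Quotient (isoSetoid κ (dimVector r μ)) //
    ∃ φ : Rep κ (fun i => Fin (dimVector r μ i)), φ.AbsolutelyIndecomposable ∧ Quotient.mk _ φ = c}
  have hex : ∀ c : A, ∃ y : NormalFormParam κ μ r, ∃ φ : Rep κ (fun i => Fin (dimVector r μ i)),
      Quotient.mk _ φ = c.1 ∧ φ.Iso (normalForm s (levels β y.1.1) y.1.2) := by
    rintro ⟨_, φ, hφ, rfl⟩
    obtain ⟨y, hy⟩ := exists_param hr hμ hβ hφ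
    exact ⟨y, φ, rfl, hy⟩
  choose Y Φ hΦ hY using hex
  let F : A × ({x : Fin r // x ≠ x₀} → κˣ) → NormalFormParam κ μ r := fun p =>
    ⟨((Y p.1).1.1, scale (levels β (Y p.1).1.1) (extendOne x₀ p.2) (Y p.1).1.2), (Y p.1).2.1, by
      dsimp only
      rw [edgeSupport_scale (extendOne_ne_zero x₀ p.2)]
      exact (Y p.1).2.2⟩
  have hF : ∀ p, (Φ p.1).Iso (normalForm s (levels β (F p).1.1) (F p).1.2) := fun p =>
    (hY p.1).trans (((scaledBy_iff (extendOne_ne_zero x₀ p.2)).mpr rfl).iso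
      (extendOne_ne_zero x₀ p.2))
  have hbij : Function.Bijective F := by
    constructor
    · rintro ⟨c, t⟩ ⟨c', t'⟩ h
      have hc : c = c' := by
        apply Subtype.ext
        rw [← hΦ c, ← hΦ c']
        have h1 := hF (c, t)
        have h2 := hF (c', t')
        rw [← h] at h2
        exact Quotient.sound (h1.trans h2.symm)
      subst hc
      have hs : scale (levels β (Y c).1.1) (extendOne x₀ t) (Y c).1.2 =
        scale (levels β (Y c).1.1) (extendOne x₀ t') (Y c).1.2 := congrArg (fun y => y.1.2) h
      -- The quotient of the two torus elements is constant along edges, hence constant, and equals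
      -- `1` at `x₀`.
      have hq := eq_of_isConnectedSpanning (Y c).2.2.2
        (fun x => extendOne x₀ t x * (extendOne x₀ t' x)⁻¹) (fun i y x hu => by
          have := congrFun hs (i, y, x)
          simp only [scale] at this
          replace this := mul_right_cancel₀ hu this
          have h1 := extendOne_ne_zero x₀ t x
          have h2 := extendOne_ne_zero x₀ t y
          have h3 := extendOne_ne_zero x₀ t' x
          have h4 := extendOne_ne_zero x₀ t' y
          split_ifs at this
          · field_simp at this ⊢
            rw [this]
          · field_simp at this ⊢
            linear_combination this)
      congr 1
      funext ⟨x, hx⟩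
      have := hq x x₀
      simp only [extendOne_self, inv_one, mul_one] at this
      have h3 := extendOne_ne_zero x₀ t' x
      rw [← div_eq_mul_inv, div_eq_one_iff_eq h3, extendOne_of_ne _ _ hx, extendOne_of_ne _ _ hx] at this
      exact Units.ext this
    · intro y
      obtain ⟨φ, hφ, hiso⟩ := exists_rep hr hβ y
      let c : A := ⟨Quotient.mk _ φ, φ, hφ, rfl⟩
      have hcy : (normalForm s (levels β (Y c).1.1) (Y c).1.2).Iso
          (normalForm s (levels β y.1.1) y.1.2) :=
        ((hY c).symm.trans (Quotient.exact (hΦ c))).trans hiso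
      have hL := (levelled_iff hβ (Y c).2.1 (Y c).1.2).mpr (Y c).2.2.1
      have hL' := (levelled_iff hβ y.2.1 y.1.2).mpr y.2.2.1
      have hw : (Y c).1.1 = y.1.1 := eq_of_levels_eq hβ (Y c).2.1 y.2.1 (levels_eq_of_iso hL hL' hcy)
      rw [← hw] at hcy hL'
      obtain ⟨g, hg⟩ := hcy
      obtain ⟨t, ht, ht0⟩ := exists_units_scalar g
      have hs := (scaledBy_iff ht0).mp
        (scaledBy_of_isHom (g := fun v => (g v).toLinearMap) ht hg hL hL')
      -- Division by `t x₀` normalizes `t`; the action involves only ratios and does not change.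
      let t' : {x : Fin r // x ≠ x₀} → κˣ := fun x =>
        Units.mk0 (t x.1 * (t x₀)⁻¹) (mul_ne_zero (ht0 _) (inv_ne_zero (ht0 _)))
      have ht' : ∀ x, extendOne x₀ t' x = t x * (t x₀)⁻¹ := fun x => by
        by_cases hx : x = x₀
        · rw [hx, extendOne_self, mul_inv_cancel₀ (ht0 _)]
        · rw [extendOne_of_ne _ _ hx]; rfl
      refine ⟨(c, t'), Subtype.ext (Prod.ext hw ?_)⟩
      refine Eq.trans ?_ hs.symm
      funext e
      simp only [F, scale, ht']
      have h1 := ht0 x₀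
      have h2 := ht0 e.2.1
      have h3 := ht0 e.2.2
      split_ifs <;> field_simp
  rw [← Nat.card_congr (Equiv.ofBijective F hbij), Nat.card_prod, Nat.card_fun, numAbsIndec,
    Nat.card_units, Nat.card_eq_fintype_card (α := {x : Fin r // x ≠ x₀}),
    Nat.card_eq_fintype_card (α := κ), Fintype.card_subtype_compl]
  simp [A]

theorem card_edgeSupport_eq [Fintype κ] [DecidableEq κ] (K : Finset (Fin k × Fin r × Fin r)) :
    (Finset.univ.filter fun u : Fin k × Fin r × Fin r → κ => edgeSupport u = K).card =
      (Fintype.card κ - 1) ^ K.card := by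
  have : (Finset.univ.filter fun u : Fin k × Fin r × Fin r → κ => edgeSupport u = K) =
      Fintype.piFinset fun e => if e ∈ K then Finset.univ.erase 0 else {0} := by
    ext u
    simp only [Finset.mem_filter, Finset.mem_univ, true_and, Fintype.mem_piFinset]
    constructor
    · rintro rfl e
      by_cases h : u e = 0 <;> simp [edgeSupport, h]
    · intro h
      ext e
      have := h e
      split_ifs at this with he
      · simp [edgeSupport, he, Finset.ne_of_mem_erase this]
      · simp [edgeSupport, he, Finset.mem_singleton.mp this]
  rw [this, Fintype.card_piFinset]
  have h : ∀ e, (if e ∈ K then Finset.univ.erase (0 : κ) else {0}).card =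
      if e ∈ K then Fintype.card κ - 1 else 1 := fun e => by
    split_ifs
    · rw [Finset.card_erase_of_mem (Finset.mem_univ _), Finset.card_univ]
    · simp
  simp only [h]
  rw [Finset.prod_ite_mem, Finset.univ_inter, Finset.prod_const]

-- Group the parameters by their support `K`: the values on `K` are arbitrary non-zero scalars.
open Classical in
theorem card_normalFormParam_eq_sum [Fintype κ] :
    Nat.card (NormalFormParam κ μ r) = ∑ w ∈ permTuples r μ,
      ∑ K ∈ (inversionEdges w).powerset.filter fun K => IsConnectedSpanning K,
        (Fintype.card κ - 1) ^ K.card := by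
  simp only [← card_edgeSupport_eq (κ := κ)]
  rw [Finset.sum_sigma', ← Finset.card_sigma, Nat.card_eq_fintype_card, Fintype.card_subtype]
  refine Finset.card_nbij' (fun y => ⟨⟨y.1, edgeSupport y.2⟩, y.2⟩) (fun z => (z.1.1, z.2)) ?_ ?_ ?_ ?_
  · rintro ⟨w, u⟩ h
    simpa using h
  · rintro ⟨⟨w, K⟩, u⟩ h
    simp only [Finset.coe_sigma, Set.mem_sigma_iff, Finset.mem_coe, Finset.mem_filter,
      Finset.mem_powerset, Finset.mem_univ, true_and] at h ⊢
    obtain ⟨⟨h1, h2, h3⟩, rfl⟩ := h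
    exact ⟨h1, h2, h3⟩
  · rintro ⟨w, u⟩ _
    rfl
  · rintro ⟨⟨w, K⟩, u⟩ h
    have : edgeSupport u = K := (Finset.mem_filter.mp (Finset.mem_sigma.mp h).2).2
    subst this
    rfl

/-- Forgetting colours can only merge edges, and a connected simple graph has at least `r - 1` of
them. So the natural subtraction in the exponent of `R` is exact. -/
theorem IsConnectedSpanning.le_card_add_one {K : Finset (Fin k × Fin r × Fin r)}
    (h : IsConnectedSpanning K) : r ≤ K.card + 1 := by
  classical
  have h1 := SimpleGraph.Connected.card_vert_le_card_edgeSet_add_one h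
  rw [Nat.card_eq_fintype_card, Fintype.card_fin] at h1
  refine h1.trans (Nat.add_le_add_right ?_ 1)
  have hsub : (SimpleGraph.fromRel fun j i : Fin r => ∃ t, (t, j, i) ∈ K).edgeSet ⊆
      (K.image fun e => s(e.2.1, e.2.2) : Finset (Sym2 (Fin r))) := by
    intro e
    induction e with
    | _ x y =>
      rw [SimpleGraph.mem_edgeSet, SimpleGraph.fromRel_adj]
      rintro ⟨-, ⟨t, ht⟩ | ⟨t, ht⟩⟩
      · exact Finset.mem_coe.mpr (Finset.mem_image.mpr ⟨_, ht, rfl⟩)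
      · exact Finset.mem_coe.mpr (Finset.mem_image.mpr ⟨_, ht, Sym2.eq_swap⟩)
  refine le_trans ?_ (Finset.card_image_le (s := K) (f := fun e => s(e.2.1, e.2.2)))
  rw [← Set.ncard_coe_finset]
  exact Set.ncard_le_ncard hsub (Finset.finite_toSet _)

open Polynomial in
theorem isKacPolynomial_sum_R (hr : 0 < r) (hμ : ∀ i, ∑ f, μ i f ≤ r) :
    IsKacPolynomial (Vertex r s) (dimVector r μ) (∑ w ∈ permTuples r μ, R w) := by
  classical
  intro κ _ _
  have hex : ∀ i, ∃ β, IsBlockMap (tilde r (μ i)) β := fun i => by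
    obtain ⟨β, h1, h2, h3⟩ := exists_block_map (tilde r (μ i)) (sum_tilde _ (hμ i))
    exact ⟨β, h1, h2, h3⟩
  choose β hβ using hex
  have h1 := card_normalFormParam (κ := κ) hr hμ hβ
  rw [card_normalFormParam_eq_sum] at h1
  have hq : 1 < Fintype.card κ := Fintype.one_lt_card
  -- Both sides are compared after multiplication by the orbit size, which is non-zero since `q ≥
  -- 2`.
  have hq0 : ((Fintype.card κ : ℤ) - 1) ^ (r - 1) ≠ 0 := pow_ne_zero _ (by omega)
  apply mul_right_cancel₀ hq0
  have h2 := congrArg (Nat.cast : ℕ → ℤ) h1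
  push_cast [Nat.cast_sub hq.le] at h2
  rw [← h2, eval_finsetSum, Finset.sum_mul]
  refine Finset.sum_congr rfl fun w _ => ?_
  rw [R, eval_finsetSum, Finset.sum_mul]
  refine Finset.sum_congr (by congr) fun K hK => ?_
  have := (Finset.mem_filter.mp hK).2.le_card_add_one
  simp only [eval_pow, eval_sub, eval_X, eval_one]
  rw [← pow_add]
  congr 1
  omega

-- The prime fields already give infinitely many common values.
open Polynomial in
theorem IsKacPolynomial.unique {I : Type} [Quiver I] {v : I → ℕ} {A B : ℤ[X]}
    (hA : IsKacPolynomial I v A) (hB : IsKacPolynomial I v B) : A = B := by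
  refine Polynomial.eq_of_infinite_eval_eq A B
    ((Nat.infinite_setOfPred_prime.image (f := fun p : ℕ => (p : ℤ)) Nat.cast_injective.injOn).mono ?_)
  rintro _ ⟨p, hp, rfl⟩
  have : Fact p.Prime := ⟨hp⟩
  have h1 := hA (ZMod p)
  have h2 := hB (ZMod p)
  rw [ZMod.card] at h1 h2
  exact h1.trans h2.symm

end Count

end Supernova

theorem theorem3p10 (r k : ℕ) (s : Fin k → ℕ) (μ : ∀ i : Fin k, Fin (s i + 1) → ℕ)
    (hμ : ∀ i, Antitone (μ i)) (hμ0 : ∀ i, μ i ≠ 0)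
    (hM : Supernova.dimVector r μ ∈ Supernova.fundamentalSet (Supernova.Vertex r s)) :
    Supernova.IsKacPolynomial (Supernova.Vertex r s) (Supernova.dimVector r μ)
        (Supernova.kacPolynomial (Supernova.Vertex r s) (Supernova.dimVector r μ)) ∧
      Supernova.kacPolynomial (Supernova.Vertex r s) (Supernova.dimVector r μ) =
        ∑ w ∈ Supernova.permTuples r μ, Supernova.R w := by
  have hle := Supernova.sum_le_of_mem_fundamentalSet μ hM
  -- For `r = 0` the bound `|μ^i| ≤ r` would make the dimension vector zero.
  have hr : 0 < r := by
    by_contra hr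
    apply hM.1
    funext x
    obtain l | ⟨i, j⟩ := x
    · exact absurd (lt_of_le_of_lt (Nat.zero_le _) l.2) hr
    · refine Finset.sum_eq_zero fun f _ => ?_
      have := (Finset.single_le_sum (f := μ i) (fun _ _ => Nat.zero_le _) (Finset.mem_univ f)).trans (hle i)
      omega
  have hR := Supernova.isKacPolynomial_sum_R (s := s) hr hle
  have hex : ∃ A, Supernova.IsKacPolynomial (Supernova.Vertex r s) (Supernova.dimVector r μ) A :=
    ⟨_, hR⟩
  have hK : Supernova.IsKacPolynomial (Supernova.Vertex r s) (Supernova.dimVector r μ)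
      (Supernova.kacPolynomial (Supernova.Vertex r s) (Supernova.dimVector r μ)) := by
    rw [Supernova.kacPolynomial, dif_pos hex]
    exact hex.choose_spec
  exact ⟨hK, hK.unique hR⟩
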